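/- Let $k$ be a field. For a finite set $A$ of positive integers let $\langle A\rangle\subseteq\mathbb N$ be the additive semigroup (containing $0$) generated by $A$; it is a numerical semigroup if $\gcd(A)=1$, and $A$ generates it minimally if no proper subset of $A$ generates the same semigroup. Let $R_A=k[x_a \mid a\in A]$, graded by $\deg x_a=a$, let $I_A$ be the kernel of the $k$-algebra homomorphism $R_A\to k[t]$, $x_a\mapsto t^a$, and let $k[A]\cong R_A/I_A$ be the semigroup ring, a graded $R_A$-module. Denote by $\beta_{i,j}(A)$ the number of basis elements of degree $j$ in the $i$-th free module of a minimal graded free resolution of $k[A]$ over $R_A$, with $\beta_{i,j}(A)=0$ for $i<0$; such a resolution exists, and these numbers do not depend on its choice. Let $\langle C\rangle$ be a numerical semigroup, minimally generated by $C$, that is obtained by gluing $\langle A\rangle$ and $\langle B\rangle$; that is, $C=k_1A\sqcup k_2B$ is a disjoint union, where $A$ and $B$ are the minimal generating sets of numerical semigroups $\langle A\rangle$ and $\langle B\rangle$, and $k_1,k_2$ are relatively prime positive integers with $k_1\in\langle B\rangle\setminus B$ and $k_2\in\langle A\rangle\setminus A$. Then, for all integers $i\ge 0$ and all integers $j$,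 $$ \beta_{i,j}(C)=\sum_{i'=0}^{i}\ \sum_{\substack{r,s\ge 0\\ k_1r+k_2s=j}}\beta_{i',r}(A)\,\bigl[\beta_{i-i',s}(B)+\beta_{i-i'-1,\,s-k_1}(B)\bigr]. $$ -/

import Mathlib

open MvPolynomial

/-- `A` is the minimal generating set of a numerical semigroup: its elements are positive integers
with greatest common divisor `1`, and no proper subset of `A` generates the same semigroup
(the semigroup `⟨A⟩` contains `0`). -/
structure IsNumericalMinGenSet (A : Finset ℕ) : Prop where
  pos : ∀ a ∈ A, 0 < a
  gcd_eq_one : A.gcd id = 1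
  minimal : ∀ A' : Finset ℕ, A' ⊂ A →
    AddSubmonoid.closure (A' : Set ℕ) ≠ AddSubmonoid.closure (A : Set ℕ)

/-- The numerical semigroup `⟨C⟩`, minimally generated by `C`, is obtained by gluing `⟨A⟩` and `⟨B⟩`
through the decomposition `C = k₁ A ⊔ k₂ B`. -/
structure IsGluing (C A B : Finset ℕ) (k₁ k₂ : ℕ) : Prop where
  genC : IsNumericalMinGenSet C
  genA : IsNumericalMinGenSet A
  genB : IsNumericalMinGenSet B
  pos₁ : 0 < k₁
  pos₂ : 0 < k₂
  coprime : Nat.Coprime k₁ k₂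
  eq_union : C = A.image (fun a => k₁ * a) ∪ B.image (fun b => k₂ * b)
  disjoint : Disjoint (A.image (fun a => k₁ * a)) (B.image (fun b => k₂ * b))
  mem₁ : k₁ ∈ AddSubmonoid.closure (B : Set ℕ)
  notMem₁ : k₁ ∉ B
  mem₂ : k₂ ∈ AddSubmonoid.closure (A : Set ℕ)
  notMem₂ : k₂ ∉ A

/-- The weight of the variable attached to `a ∈ A` is `a`. -/
def semigroupWeight (A : Finset ℕ) (a : A) : ℤ := ((a : ℕ) : ℤ)

/-- The homomorphism `φ_A : k[x_a | a ∈ A] → k[t]`, `x_a ↦ t ^ a`, whose image is the semigroup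
ring `k[A]`. -/
noncomputable def semigroupHom (k : Type*) [Field k] (A : Finset ℕ) :
    MvPolynomial A k →ₐ[k] Polynomial k :=
  aeval fun a : A => (Polynomial.X : Polynomial k) ^ (a : ℕ)

/-- The defining ideal `I_A = ker φ_A`, so that `k[A] ≅ k[x_a | a ∈ A] / I_A`. -/
noncomputable def semigroupIdeal (k : Type*) [Field k] (A : Finset ℕ) :
    Ideal (MvPolynomial A k) :=
  RingHom.ker (semigroupHom k A)

/-- A minimal graded free resolution
`⋯ → F₂ → F₁ → F₀ → S ⧸ I → 0` of `S ⧸ I` over the polynomial ring `S = k[x_v | v ∈ σ]`, graded by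
giving the variable `x_v` the weight `w v`. The free module `F_i` is `S ^ (rank i)` and its `b`-th
basis vector has degree `deg i b`, that is, `F_i = ⨁_b S(-deg i b)`. -/
structure MinimalGradedFreeResolution {k σ : Type*} [Field k] (w : σ → ℤ)
    (I : Ideal (MvPolynomial σ k)) where
  /-- the rank of `F_i` -/
  rank : ℕ → ℕ
  /-- the degrees of the basis vectors of `F_i` -/
  deg : (i : ℕ) → Fin (rank i) → ℤ
  /-- the differential `F_{i+1} → F_i` -/
  d : (i : ℕ) → (Fin (rank (i + 1)) → MvPolynomial σ k) →ₗ[MvPolynomial σ k]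
    (Fin (rank i) → MvPolynomial σ k)
  /-- the augmentation `F_0 → S ⧸ I` -/
  aug : (Fin (rank 0) → MvPolynomial σ k) →ₗ[MvPolynomial σ k] (MvPolynomial σ k ⧸ I)
  /-- the differentials are homogeneous of degree `0` -/
  d_homogeneous : ∀ (i : ℕ) (c : Fin (rank (i + 1))) (b : Fin (rank i)),
    IsWeightedHomogeneous w (d i (Pi.single c 1) b) (deg (i + 1) c - deg i b)
  /-- the augmentation is homogeneous of degree `0` -/
  aug_homogeneous : ∀ b : Fin (rank 0), ∃ f : MvPolynomial σ k,
    IsWeightedHomogeneous w f (deg 0 b) ∧ aug (Pi.single b 1) = Ideal.Quotient.mk I f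
  aug_surjective : Function.Surjective aug
  exact_aug : Function.Exact (d 0) aug
  exact_d : ∀ i : ℕ, Function.Exact (d (i + 1)) (d i)
  /-- minimality: `∂ F_{i+1} ⊆ (x_v | v ∈ σ) F_i` -/
  minimal : ∀ i : ℕ, LinearMap.range (d i) ≤
    Ideal.span (Set.range (X : σ → MvPolynomial σ k)) •
      (⊤ : Submodule (MvPolynomial σ k) (Fin (rank i) → MvPolynomial σ k))

/-- The graded Betti number `β_{i,j}`: the number of basis elements of degree `j` at the `i`-th step
of the minimal graded free resolution, with the convention `β_{i,j} = 0` for `i < 0`. -/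
def MinimalGradedFreeResolution.betti {k σ : Type*} [Field k] {w : σ → ℤ}
    {I : Ideal (MvPolynomial σ k)} (F : MinimalGradedFreeResolution w I) : ℤ → ℤ → ℕ
  | Int.ofNat i, j => (Finset.univ.filter fun b : Fin (F.rank i) => F.deg i b = j).card
  | Int.negSucc _, _ => 0

/-- Minimal graded free resolutions of the semigroup ring `k[A]` over `k[x_a | a ∈ A]`, where `x_a`
has weight `a`. -/
abbrev SemigroupRingResolution (k : Type*) [Field k] (A : Finset ℕ) :=
  MinimalGradedFreeResolution (semigroupWeight A) (semigroupIdeal k A)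

/-! Let `S` be the polynomial ring in the variables of both `A` and `B`, with weights `k₁ a` and `k₂
b`. Since `k₂ ∈ ⟨A⟩` and `k₁ ∈ ⟨B⟩`, there are exponents `u`, `v` of weights `k₂`, `k₁`, and the
binomial `ρ = x^u - y^v` is homogeneous of degree `k₁ k₂`. After relabelling, `I_C = I_A S + I_B S +
(ρ)` (`ker_monomialCurveHom_gluedWeight`): by coprimality, two monomials of equal weight differ by
trading copies of `x^u` for copies of `y^v`, up to relations inside each group of variables.

The ring `S ⧸ (I_A S + I_B S)` embeds in a polynomial ring in two variables (`ker_productHom`), so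
it is a domain, and `ρ` is nonzero in it. Hence the resolutions of `k[A]` and `k[B]`, extended to
`S`, and the complex `S → S` given by `ρ` can be tensored: each new factor stays exact modulo the
ideal already resolved, by flatness for `B` and because `ρ` is a nonzerodivisor for the last factor
(`IsFreeResolution.tensor`). The entries of the differential have no constant term, so the result is
a minimal resolution of `k[C]`. Its basis vectors have degree `k₁ r + k₂ s`, or `k₁ r + k₂ s + k₁ k₂
= k₁ r + k₂ (s + k₁)` with homological degree raised by one; counting them gives the formula.

Betti numbers are independent of the resolution because comparison maps in both directions compose
to a map homotopic to the identity, and the homotopy terms vanish modulo the variables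
(`card_le_card`). Existence comes from covering syzygies minimally, one after the other
(`nonempty_minimalGradedFreeResolution`).

A complex is stored as one free module with an endomorphism `D`. The variables get bidegree `(0, w
v)`, so bihomogeneity of `D` alone forces it to lower the homological degree by one. -/

namespace MvPolynomial

/-! ### Constant terms and weighted homogeneous components. -/

variable {k σ M : Type*} [CommRing k]

theorem mem_idealOfVars_iff_constantCoeff {p : MvPolynomial σ k} :
    p ∈ Ideal.span (Set.range (X : σ → MvPolynomial σ k)) ↔ constantCoeff p = 0 := by
  have h := mem_pow_idealOfVars_iff' (σ := σ) 1 p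
  rw [pow_one] at h
  rw [h]
  constructor
  · intro h
    exact h 0 (by simp)
  · intro h x hx
    have : x = 0 := by
      rw [Nat.lt_one_iff] at hx
      exact (Finsupp.degree_eq_zero_iff x).mp hx
    rw [this]
    exact h

/-- Turns minimality into the vanishing of constant terms of matrix entries, the form that passes
through renaming of variables and tensor products. -/
theorem mem_idealOfVars_smul_top_iff {ι : Type*} [Finite ι] {x : ι → MvPolynomial σ k} :
    x ∈ Ideal.span (Set.range (X : σ → MvPolynomial σ k)) •
      (⊤ : Submodule (MvPolynomial σ k) (ι → MvPolynomial σ k)) ↔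
      ∀ b, constantCoeff (x b) = 0 := by
  classical
  have := Fintype.ofFinite ι
  constructor
  · intro h b
    refine Submodule.smul_induction_on h ?_ ?_
    · intro r hr n _
      rw [Pi.smul_apply, smul_eq_mul, map_mul, mem_idealOfVars_iff_constantCoeff.mp hr, zero_mul]
    · intro x y hx hy
      rw [Pi.add_apply, map_add, hx, hy, add_zero]
  · intro h
    rw [pi_eq_sum_univ' x]
    exact Submodule.sum_mem _ fun b _ =>
      Submodule.smul_mem_smul (mem_idealOfVars_iff_constantCoeff.mpr (h b)) trivial

section Component

variable [AddCommGroup M] {w : σ → M}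

/-- Multiplication by a weighted homogeneous polynomial shifts weighted homogeneous components. -/
theorem weightedHomogeneousComponent_mul_of_isWeightedHomogeneous {q : MvPolynomial σ k} {a : M}
    (hq : IsWeightedHomogeneous w q a) (p : MvPolynomial σ k) {n m : M} (hnm : m = n + a) :
    weightedHomogeneousComponent w m (p * q) = weightedHomogeneousComponent w n p * q := by
  classical
  subst hnm
  ext d
  rw [coeff_weightedHomogeneousComponent, coeff_mul, coeff_mul]
  have key : ∀ x ∈ Finset.HasAntidiagonal.antidiagonal d,
      coeff x.1 (weightedHomogeneousComponent w n p) * coeff x.2 q =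
        if Finsupp.weight w d = n + a then coeff x.1 p * coeff x.2 q else 0 := by
    intro x hx
    by_cases hq0 : coeff x.2 q = 0
    · simp [hq0]
    · have hd : Finsupp.weight w d = Finsupp.weight w x.1 + a := by
        rw [← Finset.HasAntidiagonal.mem_antidiagonal.mp hx, map_add, hq hq0]
      rw [coeff_weightedHomogeneousComponent, hd]
      by_cases h : Finsupp.weight w x.1 = n
      · simp [h]
      · simp [h]
  rw [Finset.sum_congr rfl key]
  split_ifs <;> simp

/-- In a grading with positive weights, the component of degree `0` is the constant term. -/
theorem weightedHomogeneousComponent_zero_of_pos {w : σ → ℤ} (hw : ∀ v, 0 < w v)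
    (p : MvPolynomial σ k) : weightedHomogeneousComponent w 0 p = C (constantCoeff p) := by
  classical
  ext d
  rw [coeff_weightedHomogeneousComponent, coeff_C, constantCoeff_eq]
  by_cases hd : d = 0
  · simp [hd]
  · obtain ⟨v, hv⟩ := Finsupp.ne_iff.mp hd
    rw [if_neg, if_neg (Ne.symm hd)]
    rw [Finsupp.weight_apply]
    refine (Finset.sum_pos (fun u hu => ?_) ⟨v, Finsupp.mem_support_iff.mpr hv⟩).ne'
    exact smul_pos (Nat.pos_of_ne_zero (Finsupp.mem_support_iff.mp hu)) (hw u)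

theorem IsWeightedHomogeneous.nonneg {w : σ → ℤ} (hw : ∀ v, 0 < w v) {p : MvPolynomial σ k}
    (hp : p ≠ 0) {n : ℤ} (h : IsWeightedHomogeneous w p n) : 0 ≤ n := by
  obtain ⟨d, hd⟩ := ne_zero_iff.mp hp
  rw [← h hd, Finsupp.weight_apply]
  exact Finset.sum_nonneg fun v _ => smul_nonneg (Nat.zero_le _) (hw v).le

theorem IsWeightedHomogeneous.constantCoeff_eq_zero {p : MvPolynomial σ k} {n : M}
    (h : IsWeightedHomogeneous w p n) (hn : n ≠ 0) : constantCoeff p = 0 := by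
  by_contra hc
  exact hn (by simpa using (h (d := 0) hc).symm)

/-- The component of degree `n` of an element of the free module whose basis vectors have
degrees `deg`. -/
noncomputable def vecComponent {ι : Type*} (w : σ → M) (deg : ι → M) (n : M)
    (x : ι → MvPolynomial σ k) : ι → MvPolynomial σ k :=
  fun b => weightedHomogeneousComponent w (n - deg b) (x b)

variable {ι κ : Type*} {deg : ι → M} {deg' : κ → M}

/-- A matrix with homogeneous entries only shifts degrees. This makes kernels of graded maps graded,
and isolates one degree of a relation among generators. -/
theorem vecComponent_linearCombination [Fintype κ] {g : κ → ι → MvPolynomial σ k}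
    (hg : ∀ c b, IsWeightedHomogeneous w (g c b) (deg' c - deg b)) (n : M)
    (x : κ → MvPolynomial σ k) :
    vecComponent w deg n (Fintype.linearCombination (MvPolynomial σ k) g x) =
      Fintype.linearCombination (MvPolynomial σ k) g (vecComponent w deg' n x) := by
  funext b
  simp only [vecComponent, Fintype.linearCombination_apply, Finset.sum_apply, Pi.smul_apply,
    smul_eq_mul, map_sum]
  refine Finset.sum_congr rfl fun c _ => ?_
  exact weightedHomogeneousComponent_mul_of_isWeightedHomogeneous (hg c b) _ (by abel)

theorem exists_eq_sum_vecComponent [Finite ι] (w : σ → M) (deg : ι → M)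
    (x : ι → MvPolynomial σ k) : ∃ s : Finset M, x = ∑ n ∈ s, vecComponent w deg n x := by
  classical
  have := Fintype.ofFinite ι
  refine ⟨Finset.univ.biUnion fun b => (x b).support.image fun d => Finsupp.weight w d + deg b, ?_⟩
  funext b
  ext d
  simp only [vecComponent, Finset.sum_apply, coeff_sum, coeff_weightedHomogeneousComponent]
  by_cases hd : coeff d (x b) = 0
  · simp [hd]
  rw [Finset.sum_eq_single (Finsupp.weight w d + deg b)]
  · simp
  · intro n _ hn
    rw [if_neg]
    rintro h
    exact hn (by rw [h]; abel)
  · intro h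
    exact absurd (Finset.mem_biUnion.mpr ⟨b, Finset.mem_univ _,
      Finset.mem_image_of_mem _ (mem_support_iff.mpr hd)⟩) h

end Component

/-! ### Existence of minimal graded free resolutions. -/

section MinimalCover

variable {k σ : Type*} [Field k] [Finite σ] {w : σ → ℤ}

/-- A graded submodule of a free module, given by the degrees of the basis vectors. -/
def IsGradedSubmodule {ι : Type*} (w : σ → ℤ) (deg : ι → ℤ)
    (N : Submodule (MvPolynomial σ k) (ι → MvPolynomial σ k)) : Prop :=
  ∀ x ∈ N, ∀ n, vecComponent w deg n x ∈ N

/-- By noetherianity there are finitely many generators; their components lie in `N` and still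
generate, each generator being the sum of its components. -/
theorem IsGradedSubmodule.exists_finset_span {ι : Type*} [Finite ι] {deg : ι → ℤ}
    {N : Submodule (MvPolynomial σ k) (ι → MvPolynomial σ k)} (hN : IsGradedSubmodule w deg N) :
    ∃ T : Finset (ι → MvPolynomial σ k),
      (∀ g ∈ T, ∃ n, ∀ b, IsWeightedHomogeneous w (g b) (n - deg b)) ∧
      Submodule.span (MvPolynomial σ k) (T : Set (ι → MvPolynomial σ k)) = N := by
  classical
  obtain ⟨t, ht⟩ := IsNoetherian.noetherian N
  choose s hs using fun x : ι → MvPolynomial σ k => exists_eq_sum_vecComponent w deg x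
  refine ⟨t.biUnion fun x => (s x).image fun n => vecComponent w deg n x, ?_, ?_⟩
  · intro g hg
    simp only [Finset.mem_biUnion, Finset.mem_image] at hg
    obtain ⟨x, _, n, _, rfl⟩ := hg
    exact ⟨n, fun b => weightedHomogeneousComponent_isWeightedHomogeneous _ _⟩
  · apply le_antisymm
    · rw [Submodule.span_le]
      intro g hg
      simp only [Finset.coe_biUnion, Set.mem_iUnion, Finset.coe_image, Set.mem_image] at hg
      obtain ⟨x, hx, n, _, rfl⟩ := hg
      exact hN x (ht ▸ Submodule.subset_span hx) n
    · rw [← ht, Submodule.span_le]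
      intro x hx
      rw [hs x]
      refine Submodule.sum_mem _ fun n hn => Submodule.subset_span ?_
      exact Finset.mem_coe.mpr (Finset.mem_biUnion.mpr ⟨x, hx, Finset.mem_image_of_mem _ hn⟩)

/-- A graded submodule of a graded free module of finite rank has a minimal graded cover. -/
theorem IsGradedSubmodule.exists_minimal_cover (hw : ∀ v, 0 < w v) {ι : Type*} [Finite ι]
    {deg : ι → ℤ} {N : Submodule (MvPolynomial σ k) (ι → MvPolynomial σ k)}
    (hN : IsGradedSubmodule w deg N) :
    ∃ (r : ℕ) (deg' : Fin r → ℤ)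
      (d : (Fin r → MvPolynomial σ k) →ₗ[MvPolynomial σ k] (ι → MvPolynomial σ k)),
      (∀ c b, IsWeightedHomogeneous w (d (Pi.single c 1) b) (deg' c - deg b)) ∧
      LinearMap.range d = N ∧ (∀ x ∈ LinearMap.ker d, ∀ c, constantCoeff (x c) = 0) ∧
      IsGradedSubmodule w deg' (LinearMap.ker d) := by
  classical
  -- A homogeneous generating set of least cardinality; this choice is the source of minimality.
  obtain ⟨T, ⟨hT, hTN⟩, hmin⟩ := (measure (Finset.card (α := ι → MvPolynomial σ k))).wf.has_min
    {T | (∀ g ∈ T, ∃ n, ∀ b, IsWeightedHomogeneous w (g b) (n - deg b)) ∧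
      Submodule.span (MvPolynomial σ k) (T : Set (ι → MvPolynomial σ k)) = N}
    hN.exists_finset_span
  set g : Fin T.card → ι → MvPolynomial σ k := fun c => (T.equivFin.symm c : _) with hg
  have hgT : ∀ c, g c ∈ T := fun c => (T.equivFin.symm c).2
  have hginj : Function.Injective g := Subtype.val_injective.comp T.equivFin.symm.injective
  have hrange : Set.range g = T := by
    ext x
    constructor
    · rintro ⟨c, rfl⟩
      exact hgT c
    · intro hx
      exact ⟨T.equivFin ⟨x, hx⟩, by simp [hg]⟩
  choose deg' hdeg' using fun c => hT (g c) (hgT c)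
  refine ⟨T.card, deg', Fintype.linearCombination _ g, ?_, ?_, ?_, ?_⟩
  · intro c b
    rw [Fintype.linearCombination_apply_single, one_smul]
    exact hdeg' c b
  · rw [Fintype.range_linearCombination, hrange, hTN]
  · intro x hx c
    -- If the coefficient at `c` had a nonzero constant term, the component of the relation in
    -- degree `deg' c` would have a nonzero scalar there, and `g c` could be removed from the
    -- generators.
    by_contra hc
    rw [LinearMap.mem_ker] at hx
    have h := vecComponent_linearCombination hdeg' (deg' c) x
    rw [hx] at h
    have h0 : vecComponent w deg (deg' c) (0 : ι → MvPolynomial σ k) = 0 := by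
      funext b; simp [vecComponent]
    rw [h0, Fintype.linearCombination_apply, ← Finset.add_sum_erase _ _ (Finset.mem_univ c)] at h
    have hcomp : vecComponent w deg' (deg' c) x c = C (constantCoeff (x c)) := by
      simp only [vecComponent, sub_self]
      exact weightedHomogeneousComponent_zero_of_pos hw _
    rw [hcomp] at h
    have hmem : g c ∈ Submodule.span (MvPolynomial σ k)
        ((T.erase (g c) : Finset _) : Set (ι → MvPolynomial σ k)) := by
      have h1 : ∑ c' ∈ Finset.univ.erase c, vecComponent w deg' (deg' c) x c' • g c' ∈
          Submodule.span (MvPolynomial σ k)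
            ((T.erase (g c) : Finset _) : Set (ι → MvPolynomial σ k)) := by
        refine Submodule.sum_mem _ fun c' hc' =>
          Submodule.smul_mem _ _ (Submodule.subset_span ?_)
        exact Finset.mem_coe.mpr (Finset.mem_erase.mpr
          ⟨fun e => (Finset.ne_of_mem_erase hc') (hginj e), hgT c'⟩)
      have h2 := Submodule.smul_mem _ (-C (constantCoeff (x c))⁻¹ : MvPolynomial σ k) h1
      rwa [← neg_eq_of_add_eq_zero_right h.symm, neg_smul, smul_neg, neg_neg, smul_smul, ← C_mul,
        inv_mul_cancel₀ hc, C_1, one_smul] at h2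
    refine hmin (T.erase (g c)) ⟨fun y hy => hT y (Finset.mem_of_mem_erase hy), ?_⟩
      (Finset.card_erase_lt_of_mem (hgT c))
    apply le_antisymm
    · rw [← hTN]
      exact Submodule.span_mono (by simp)
    · rw [← hTN, Submodule.span_le]
      intro y hy
      by_cases hyc : y = g c
      · rw [hyc]; exact hmem
      · exact Submodule.subset_span (by simpa using ⟨hy, hyc⟩)
  · intro x hx n
    rw [LinearMap.mem_ker] at hx ⊢
    rw [← vecComponent_linearCombination hdeg', hx]
    funext b; simp [vecComponent]

/-- A graded submodule of a graded free module of finite rank. -/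
structure GradedSubmoduleOfFree (k : Type*) [Field k] {σ : Type*} (w : σ → ℤ) where
  /-- the rank of the free module -/
  rank : ℕ
  /-- the degrees of the basis vectors -/
  deg : Fin rank → ℤ
  /-- the submodule -/
  carrier : Submodule (MvPolynomial σ k) (Fin rank → MvPolynomial σ k)
  isGraded : IsGradedSubmodule w deg carrier

/-- A minimal graded cover of a graded submodule of a free module. -/
structure MinimalGradedCover (N : GradedSubmoduleOfFree k w) where
  /-- the kernel of the cover, inside the covering free module -/
  kernel : GradedSubmoduleOfFree k w
  /-- the covering map -/
  map : (Fin kernel.rank → MvPolynomial σ k) →ₗ[MvPolynomial σ k] (Fin N.rank → MvPolynomial σ k)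
  map_homogeneous : ∀ c b,
    IsWeightedHomogeneous w (map (Pi.single c 1) b) (kernel.deg c - N.deg b)
  mem_range_map_iff : ∀ y, y ∈ Set.range map ↔ y ∈ N.carrier
  map_eq_zero_iff : ∀ x, map x = 0 ↔ x ∈ kernel.carrier
  minimal : ∀ x ∈ kernel.carrier, ∀ c, constantCoeff (x c) = 0

theorem nonempty_minimalGradedCover (hw : ∀ v, 0 < w v) (N : GradedSubmoduleOfFree k w) :
    Nonempty (MinimalGradedCover N) := by
  obtain ⟨r, deg', d, h1, h2, h3, h4⟩ := N.isGraded.exists_minimal_cover hw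
  exact ⟨⟨⟨r, deg', LinearMap.ker d, h4⟩, d, h1, fun y => by rw [← h2]; rfl, fun _ => Iff.rfl, h3⟩⟩

/-- The iterated syzygies of a graded submodule of a free module. -/
noncomputable def syzygy (hw : ∀ v, 0 < w v) (N : GradedSubmoduleOfFree k w) :
    ℕ → GradedSubmoduleOfFree k w
  | 0 => N
  | i + 1 => (nonempty_minimalGradedCover hw (syzygy hw N i)).some.kernel

/-- A proper homogeneous ideal has a minimal graded free resolution. -/
theorem nonempty_minimalGradedFreeResolution (hw : ∀ v, 0 < w v) {I : Ideal (MvPolynomial σ k)}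
    (hI : ∀ p ∈ I, ∀ n, weightedHomogeneousComponent w n p ∈ I)
    (hI' : ∀ p ∈ I, constantCoeff p = 0) :
    Nonempty (MinimalGradedFreeResolution w I) := by
  let N : GradedSubmoduleOfFree k w :=
    { rank := 1
      deg := fun _ => 0
      carrier := Submodule.comap (LinearMap.proj 0 :
        (Fin 1 → MvPolynomial σ k) →ₗ[MvPolynomial σ k] MvPolynomial σ k) I
      isGraded := fun x hx n => by
        simp only [Submodule.mem_comap, LinearMap.proj_apply] at hx ⊢
        exact hI _ hx _ }
  let cov := fun i => (nonempty_minimalGradedCover hw (syzygy hw N i)).some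
  refine ⟨{
    rank := fun i => (syzygy hw N i).rank
    deg := fun i => (syzygy hw N i).deg
    d := fun i => (cov i).map
    aug := (Ideal.Quotient.mkₐ (MvPolynomial σ k) I).toLinearMap ∘ₗ
      (LinearMap.proj 0 : (Fin 1 → MvPolynomial σ k) →ₗ[MvPolynomial σ k] MvPolynomial σ k)
    d_homogeneous := fun i => (cov i).map_homogeneous
    aug_homogeneous := ?_
    aug_surjective := ?_
    exact_aug := ?_
    exact_d := ?_
    minimal := ?_ }⟩
  · intro b
    have hb : b = (0 : Fin 1) := Subsingleton.elim (α := Fin 1) _ _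
    subst hb
    exact ⟨1, isWeightedHomogeneous_one k w, rfl⟩
  · intro y
    obtain ⟨p, rfl⟩ := Ideal.Quotient.mk_surjective y
    exact ⟨fun _ => p, rfl⟩
  · intro x
    exact Iff.trans Ideal.Quotient.eq_zero_iff_mem ((cov 0).mem_range_map_iff x).symm
  · intro i x
    exact ((cov i).map_eq_zero_iff x).trans ((cov (i + 1)).mem_range_map_iff x).symm
  · intro i x hx
    have hx : x ∈ (syzygy hw N i).carrier := ((cov i).mem_range_map_iff x).mp hx
    rw [mem_idealOfVars_smul_top_iff]
    -- The first differential has range `I`, where `hI'` applies; each later range is the kernel of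
    -- a minimal cover.
    cases i with
    | zero =>
      intro b
      have hb : b = (0 : Fin 1) := Subsingleton.elim (α := Fin 1) _ _
      subst hb
      exact hI' (x (0 : Fin 1)) hx
    | succ i => exact (cov i).minimal x hx

end MinimalCover

end MvPolynomial

/-! ### Resolutions collected in a single bigraded free module. -/

theorem Finsupp.linearMap_apply_eq_sum {R ι N : Type*} [CommRing R] [AddCommGroup N] [Module R N]
    (L : (ι →₀ R) →ₗ[R] N) (x : ι →₀ R) : L x = x.sum fun b r => r • L (Finsupp.single b 1) := by
  conv_lhs => rw [← Finsupp.sum_single x]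
  rw [map_finsuppSum]
  refine Finsupp.sum_congr fun b _ => ?_
  rw [← map_smul, Finsupp.smul_single_one]

/-- Identities for chain maps and homotopies are known only on basis vectors of low homological
degree; this carries them over to vectors supported there. -/
theorem Finsupp.linearMap_congr_on_support {R ι N : Type*} [CommRing R] [AddCommGroup N]
    [Module R N] {L L' : (ι →₀ R) →ₗ[R] N} {x : ι →₀ R}
    (h : ∀ b ∈ x.support, L (Finsupp.single b 1) = L' (Finsupp.single b 1)) : L x = L' x := by
  rw [Finsupp.linearMap_apply_eq_sum, Finsupp.linearMap_apply_eq_sum L']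
  exact Finsupp.sum_congr fun b hb => by rw [h b hb]

theorem Finsupp.linearMap_mem_of_support {R ι N : Type*} [CommRing R] [AddCommGroup N]
    [Module R N] {L : (ι →₀ R) →ₗ[R] N} {P : Submodule R N} {x : ι →₀ R}
    (h : ∀ b ∈ x.support, L (Finsupp.single b 1) ∈ P) : L x ∈ P := by
  rw [Finsupp.linearMap_apply_eq_sum]
  exact Submodule.sum_mem _ fun b hb => Submodule.smul_mem _ _ (h b hb)

/-- The endomorphism `D` of a free module and the augmentation `ε` (taken modulo `I`) form a
resolution of `R ⧸ I`, all homological degrees being collected in one free module. -/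
structure IsFreeResolution {R ι : Type*} [CommRing R] (D : (ι →₀ R) →ₗ[R] (ι →₀ R))
    (ε : (ι →₀ R) →ₗ[R] R) (I : Ideal R) : Prop where
  D_D : ∀ x, D (D x) = 0
  ε_D : ∀ x, ε (D x) ∈ I
  ε_surjective : ∃ x, ε x - 1 ∈ I
  exact : ∀ x, D x = 0 → ε x ∈ I → ∃ y, D y = x

/-- The weights of the variables in the bigrading by homological and internal degree. -/
def bigradedWeight {σ : Type*} (w : σ → ℤ) (v : σ) : ℤ × ℤ := (0, w v)

/-- A minimal graded free resolution of `S ⧸ I` whose free modules are collected into a single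
bigraded free module with basis `ι`. -/
structure TotalResolution {k σ : Type*} [Field k] (w : σ → ℤ) (I : Ideal (MvPolynomial σ k))
    (ι : Type*) where
  /-- the differential -/
  D : (ι →₀ MvPolynomial σ k) →ₗ[MvPolynomial σ k] (ι →₀ MvPolynomial σ k)
  /-- the augmentation -/
  ε : (ι →₀ MvPolynomial σ k) →ₗ[MvPolynomial σ k] MvPolynomial σ k
  /-- the homological degree of a basis vector -/
  hdeg : ι → ℕ
  /-- the internal degree of a basis vector -/
  deg : ι → ℤ
  D_homogeneous : ∀ b c, IsWeightedHomogeneous (bigradedWeight w) (D (Finsupp.single b 1) c)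
    (((hdeg b : ℤ), deg b) - ((hdeg c : ℤ), deg c) - (1, 0))
  ε_homogeneous : ∀ b, IsWeightedHomogeneous (bigradedWeight w) (ε (Finsupp.single b 1))
    ((hdeg b : ℤ), deg b)
  D_minimal : ∀ b c, constantCoeff (D (Finsupp.single b 1) c) = 0
  isFreeResolution : IsFreeResolution D ε I

section Bigraded

variable {k σ : Type*} [CommRing k] {w : σ → ℤ}

theorem weight_bigradedWeight (d : σ →₀ ℕ) :
    Finsupp.weight (bigradedWeight w) d = ((0 : ℤ), Finsupp.weight w d) := by
  simp only [Finsupp.weight_apply, Finsupp.sum, bigradedWeight]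
  ext <;> simp [Prod.fst_sum, Prod.snd_sum]

theorem isWeightedHomogeneous_bigradedWeight_iff {p : MvPolynomial σ k} {n : ℤ} :
    IsWeightedHomogeneous (bigradedWeight w) p (0, n) ↔ IsWeightedHomogeneous w p n := by
  simp only [IsWeightedHomogeneous, weight_bigradedWeight, Prod.mk.injEq, true_and]

/-- Every monomial has homological weight `0`. Vanishing for reasons of homological degree is
deduced from this. -/
theorem MvPolynomial.IsWeightedHomogeneous.eq_zero_of_fst_ne_zero {p : MvPolynomial σ k}
    {m : ℤ × ℤ} (hp : IsWeightedHomogeneous (bigradedWeight w) p m) (hm : m.1 ≠ 0) : p = 0 := by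
  ext d
  by_contra hd
  have := hp hd
  rw [weight_bigradedWeight] at this
  exact hm (by rw [← this])

theorem weightedHomogeneousComponent_bigradedWeight (p : MvPolynomial σ k) (n : ℤ) :
    weightedHomogeneousComponent (bigradedWeight w) (0, n) p =
      weightedHomogeneousComponent w n p := by
  classical
  ext d
  simp only [coeff_weightedHomogeneousComponent, weight_bigradedWeight, Prod.mk.injEq, true_and]

theorem weightedHomogeneousComponent_bigradedWeight_mem {I : Ideal (MvPolynomial σ k)}
    (hI : ∀ p ∈ I, ∀ n, weightedHomogeneousComponent w n p ∈ I) {p : MvPolynomial σ k}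
    (hp : p ∈ I) (m : ℤ × ℤ) : weightedHomogeneousComponent (bigradedWeight w) m p ∈ I := by
  obtain ⟨a, n⟩ := m
  by_cases ha : a = 0
  · rw [ha, weightedHomogeneousComponent_bigradedWeight]
    exact hI p hp n
  · rw [(weightedHomogeneousComponent_isWeightedHomogeneous (a, n) p).eq_zero_of_fst_ne_zero ha]
    exact I.zero_mem

end Bigraded

/-! ### Comparison of resolutions and invariance of Betti numbers. -/

namespace TotalResolution

variable {k σ : Type*} [Field k] {w : σ → ℤ} {I : Ideal (MvPolynomial σ k)} {ι κ : Type*}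

section Basic

variable (F : TotalResolution w I ι)

/-- The bidegree of a basis vector. -/
def bideg (b : ι) : ℤ × ℤ := ((F.hdeg b : ℤ), F.deg b)

theorem hdeg_of_D_ne_zero {b c : ι} (h : F.D (Finsupp.single b 1) c ≠ 0) :
    F.hdeg b = F.hdeg c + 1 := by
  by_contra hne
  refine h ((F.D_homogeneous b c).eq_zero_of_fst_ne_zero ?_)
  simp only [Prod.fst_sub]
  omega

theorem D_single_of_hdeg_eq_zero {b : ι} (h : F.hdeg b = 0) : F.D (Finsupp.single b 1) = 0 := by
  ext1 c
  by_contra hc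
  have := F.hdeg_of_D_ne_zero hc
  omega

theorem ε_single_of_hdeg_ne_zero {b : ι} (h : F.hdeg b ≠ 0) : F.ε (Finsupp.single b 1) = 0 :=
  (F.ε_homogeneous b).eq_zero_of_fst_ne_zero (by simpa using h)

/-- `D` kills the basis vectors of homological degree `0` and `ε` kills all others, so dropping the
degree-zero part of a preimage keeps its boundary and makes its augmentation vanish. -/
theorem exact_ε (x : ι →₀ MvPolynomial σ k) (hx : F.D x = 0) (hx' : F.ε x ∈ I) :
    ∃ y, F.D y = x ∧ F.ε y = 0 := by
  classical
  obtain ⟨y, rfl⟩ := F.isFreeResolution.exact x hx hx'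
  refine ⟨y.filter fun b => F.hdeg b ≠ 0, ?_, ?_⟩
  · conv_rhs => rw [← Finsupp.filter_add_filter_not y fun b => F.hdeg b ≠ 0, map_add]
    rw [left_eq_add, ← Submodule.mem_bot (MvPolynomial σ k)]
    refine Finsupp.linearMap_mem_of_support fun b hb => ?_
    rw [Finsupp.support_filter, Finset.mem_filter, not_not] at hb
    rw [F.D_single_of_hdeg_eq_zero hb.2]
    exact Submodule.zero_mem _
  · rw [← Submodule.mem_bot (MvPolynomial σ k)]
    refine Finsupp.linearMap_mem_of_support fun b hb => ?_
    rw [Finsupp.support_filter, Finset.mem_filter] at hb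
    rw [F.ε_single_of_hdeg_ne_zero hb.2]
    exact Submodule.zero_mem _

theorem constantCoeff_D (x : ι →₀ MvPolynomial σ k) (c : ι) : constantCoeff (F.D x c) = 0 := by
  rw [Finsupp.linearMap_apply_eq_sum, Finsupp.sum_apply, Finsupp.sum, map_sum]
  refine Finset.sum_eq_zero fun b _ => ?_
  rw [Finsupp.smul_apply, smul_eq_mul, map_mul, F.D_minimal, mul_zero]

/-- Internal degrees are nonnegative. -/
theorem deg_nonneg (hw : ∀ v, 0 < w v) (b : ι) : 0 ≤ F.deg b := by
  induction hn : F.hdeg b using Nat.strong_induction_on generalizing b with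
  | _ n ih =>
  by_cases hD : F.D (Finsupp.single b 1) = 0
  · by_cases hε : F.ε (Finsupp.single b 1) ∈ I
    -- Here the basis vector itself would be a boundary, although coordinates of boundaries have no
    -- constant term.
    · obtain ⟨y, hy⟩ := F.isFreeResolution.exact _ hD hε
      have h1 := F.constantCoeff_D y b
      rw [hy] at h1
      simp at h1
    · have h0 : F.ε (Finsupp.single b 1) ≠ 0 := fun h => hε (h ▸ I.zero_mem)
      have hh : F.hdeg b = 0 := by
        by_contra h
        exact h0 (F.ε_single_of_hdeg_ne_zero h)
      have h1 := F.ε_homogeneous b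
      rw [hh, Nat.cast_zero, isWeightedHomogeneous_bigradedWeight_iff] at h1
      exact h1.nonneg hw h0
  · obtain ⟨c, hc⟩ := Finsupp.ne_iff.mp hD
    have hh := F.hdeg_of_D_ne_zero hc
    have h1 := F.D_homogeneous b c
    rw [show (((F.hdeg b : ℤ), F.deg b) - ((F.hdeg c : ℤ), F.deg c) - (1, 0) : ℤ × ℤ) =
      (0, F.deg b - F.deg c) by ext <;> simp [hh], isWeightedHomogeneous_bigradedWeight_iff] at h1
    have h2 := h1.nonneg hw hc
    have h3 := ih _ (by omega) c rfl
    omega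

/-- Elements of bidegree `m`. -/
def IsHomogeneous (m : ℤ × ℤ) (x : ι →₀ MvPolynomial σ k) : Prop :=
  ∀ c, IsWeightedHomogeneous (bigradedWeight w) (x c) (m - F.bideg c)

open Classical in
/-- The component of bidegree `m`. -/
noncomputable def component (m : ℤ × ℤ) (x : ι →₀ MvPolynomial σ k) : ι →₀ MvPolynomial σ k :=
  Finsupp.onFinset x.support
    (fun c => weightedHomogeneousComponent (bigradedWeight w) (m - F.bideg c) (x c))
    (fun c hc => by
      rw [Finsupp.mem_support_iff]
      intro h
      exact hc (by rw [h, map_zero]))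

theorem component_isHomogeneous (m : ℤ × ℤ) (x : ι →₀ MvPolynomial σ k) :
    F.IsHomogeneous m (F.component m x) :=
  fun _ => weightedHomogeneousComponent_isWeightedHomogeneous _ _

/-- Because `D` is homogeneous of bidegree `(-1, 0)`, a preimage of a homogeneous vector can be
replaced by one of its components. -/
theorem D_component (m : ℤ × ℤ) (x : ι →₀ MvPolynomial σ k) (c : ι) :
    F.D (F.component m x) c =
      weightedHomogeneousComponent (bigradedWeight w) (m - (1, 0) - F.bideg c) (F.D x c) := by
  rw [Finsupp.linearMap_apply_eq_sum, Finsupp.linearMap_apply_eq_sum F.D x, component,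
    Finsupp.onFinset_sum _ (by simp), Finsupp.sum, Finsupp.finsetSum_apply,
    Finsupp.finsetSum_apply, map_sum]
  refine Finset.sum_congr rfl fun b _ => ?_
  simp only [Finsupp.smul_apply, smul_eq_mul]
  refine (weightedHomogeneousComponent_mul_of_isWeightedHomogeneous (F.D_homogeneous b c) _ ?_).symm
  simp only [bideg]
  abel

theorem ε_component (m : ℤ × ℤ) (x : ι →₀ MvPolynomial σ k) :
    F.ε (F.component m x) =
      weightedHomogeneousComponent (bigradedWeight w) m (F.ε x) := by
  rw [Finsupp.linearMap_apply_eq_sum, Finsupp.linearMap_apply_eq_sum F.ε x, component,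
    Finsupp.onFinset_sum _ (by simp), Finsupp.sum, map_sum]
  refine Finset.sum_congr rfl fun b _ => ?_
  simp only [smul_eq_mul]
  refine (weightedHomogeneousComponent_mul_of_isWeightedHomogeneous (F.ε_homogeneous b) _ ?_).symm
  simp only [bideg]
  abel

variable {F} in
theorem IsHomogeneous.map {N : TotalResolution w I κ}
    {f : (ι →₀ MvPolynomial σ k) →ₗ[MvPolynomial σ k] (κ →₀ MvPolynomial σ k)}
    {x : ι →₀ MvPolynomial σ k} {m a : ℤ × ℤ} (hx : F.IsHomogeneous m x)
    (hf : ∀ b ∈ x.support, N.IsHomogeneous (F.bideg b - a) (f (Finsupp.single b 1))) :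
    N.IsHomogeneous (m - a) (f x) := by
  intro c
  rw [Finsupp.linearMap_apply_eq_sum, Finsupp.sum, Finsupp.finsetSum_apply]
  refine IsWeightedHomogeneous.sum _ _ _ fun b hb => ?_
  have h := (hx b).mul (hf b hb c)
  rwa [show m - F.bideg b + (F.bideg b - a - N.bideg c) = m - a - N.bideg c by abel] at h

end Basic

variable (F : TotalResolution w I ι) (G : TotalResolution w I κ)

theorem hdeg_lt_of_mem_support_D {b c : ι} (hc : c ∈ (F.D (Finsupp.single b 1)).support) :
    F.hdeg c < F.hdeg b := by
  rw [F.hdeg_of_D_ne_zero (Finsupp.mem_support_iff.mp hc)]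
  exact Nat.lt_succ_self _

/-- The identity of `S ⧸ I` lifts to a bihomogeneous chain map in homological degrees below `n`. -/
theorem exists_chainMap (hI : ∀ p ∈ I, ∀ n, weightedHomogeneousComponent w n p ∈ I) (n : ℕ) :
    ∃ f : (ι →₀ MvPolynomial σ k) →ₗ[MvPolynomial σ k] (κ →₀ MvPolynomial σ k),
      ∀ b, F.hdeg b < n → G.D (f (Finsupp.single b 1)) = f (F.D (Finsupp.single b 1)) ∧
        G.ε (f (Finsupp.single b 1)) - F.ε (Finsupp.single b 1) ∈ I ∧
        G.IsHomogeneous (F.bideg b) (f (Finsupp.single b 1)) := by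
  classical
  induction n with
  | zero => exact ⟨0, fun b hb => absurd hb (Nat.not_lt_zero _)⟩
  | succ n ih =>
  obtain ⟨f, hf⟩ := ih
  have key : ∀ b, F.hdeg b = n → ∃ y, G.D y = f (F.D (Finsupp.single b 1)) ∧
      G.ε y - F.ε (Finsupp.single b 1) ∈ I ∧ G.IsHomogeneous (F.bideg b) y := by
    intro b hb
    rcases Nat.eq_zero_or_pos n with rfl | hn
    -- Since `G.ε x` is `1` modulo `I`, the multiple of `x` by the augmentation of the basis vector
    -- has the right augmentation; passing to a component makes it homogeneous.
    · obtain ⟨x, hx⟩ := G.isFreeResolution.ε_surjective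
      refine ⟨G.component (F.bideg b) (F.ε (Finsupp.single b 1) • x), ?_, ?_,
        G.component_isHomogeneous _ _⟩
      · rw [F.D_single_of_hdeg_eq_zero hb, map_zero]
        ext1 c
        rw [D_component]
        refine (weightedHomogeneousComponent_isWeightedHomogeneous _ _).eq_zero_of_fst_ne_zero ?_
        simp only [bideg, Prod.fst_sub]
        omega
      · rw [ε_component]
        have h1 : weightedHomogeneousComponent (bigradedWeight w) (F.bideg b)
            (F.ε (Finsupp.single b 1)) = F.ε (Finsupp.single b 1) :=
          (F.ε_homogeneous b).weightedHomogeneousComponent_same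
        suffices h : weightedHomogeneousComponent (bigradedWeight w) (F.bideg b)
            (G.ε (F.ε (Finsupp.single b 1) • x) - F.ε (Finsupp.single b 1)) ∈ I by
          rwa [map_sub, h1] at h
        refine weightedHomogeneousComponent_bigradedWeight_mem hI ?_ _
        rw [map_smul, smul_eq_mul]
        have := I.mul_mem_left (F.ε (Finsupp.single b 1)) hx
        rwa [mul_sub, mul_one] at this
    · have hsupp : ∀ c ∈ (F.D (Finsupp.single b 1)).support, F.hdeg c < n :=
        fun c hc => hb ▸ F.hdeg_lt_of_mem_support_D hc
      have h1 : G.D (f (F.D (Finsupp.single b 1))) = 0 := by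
        have : (G.D ∘ₗ f) (F.D (Finsupp.single b 1)) = (f ∘ₗ F.D) (F.D (Finsupp.single b 1)) :=
          Finsupp.linearMap_congr_on_support fun c hc => (hf c (hsupp c hc)).1
        simpa [F.isFreeResolution.D_D] using this
      have h2 : G.ε (f (F.D (Finsupp.single b 1))) ∈ I := by
        have : (G.ε ∘ₗ f - F.ε) (F.D (Finsupp.single b 1)) ∈ I :=
          Finsupp.linearMap_mem_of_support fun c hc => (hf c (hsupp c hc)).2.1
        have := I.add_mem this (F.isFreeResolution.ε_D (Finsupp.single b 1))
        simpa using this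
      obtain ⟨y, hy⟩ := G.isFreeResolution.exact _ h1 h2
      have hhom : G.IsHomogeneous (F.bideg b - (1, 0) - 0) (f (F.D (Finsupp.single b 1))) := by
        refine IsHomogeneous.map (F := F) (fun c => ?_) fun c hc => ?_
        · convert F.D_homogeneous b c using 1
          simp only [bideg]
          abel
        · rw [sub_zero]
          exact (hf c (hsupp c hc)).2.2
      refine ⟨G.component (F.bideg b) y, ?_, ?_, G.component_isHomogeneous _ _⟩
      · ext1 c
        rw [D_component, hy]
        have := hhom c
        rw [sub_zero] at this
        exact this.weightedHomogeneousComponent_same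
      · have hb0 : (F.bideg b).1 ≠ 0 := by simp only [bideg]; omega
        rw [ε_component, F.ε_single_of_hdeg_ne_zero (by omega), sub_zero,
          (weightedHomogeneousComponent_isWeightedHomogeneous _ _).eq_zero_of_fst_ne_zero hb0]
        exact I.zero_mem
  choose! Y hY using key
  let f' : (ι →₀ MvPolynomial σ k) →ₗ[MvPolynomial σ k] (κ →₀ MvPolynomial σ k) :=
    Finsupp.linearCombination _ fun b => if F.hdeg b = n then Y b else f (Finsupp.single b 1)
  have hf' : ∀ b, f' (Finsupp.single b 1) =
      if F.hdeg b = n then Y b else f (Finsupp.single b 1) := by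
    intro b
    simp [f']
  have hfD : ∀ b, F.hdeg b < n + 1 →
      f' (F.D (Finsupp.single b 1)) = f (F.D (Finsupp.single b 1)) := by
    intro b hb
    refine Finsupp.linearMap_congr_on_support fun c hc => ?_
    have := F.hdeg_lt_of_mem_support_D hc
    rw [hf', if_neg (by omega)]
  refine ⟨f', fun b hb => ?_⟩
  rw [hfD b hb, hf']
  split_ifs with h
  · exact hY b h
  · exact hf b (by omega)

/-- A chain endomorphism lifting the identity of `S ⧸ I` is homotopic to the identity. -/
theorem exists_homotopy (n : ℕ)
    (φ : (ι →₀ MvPolynomial σ k) →ₗ[MvPolynomial σ k] (ι →₀ MvPolynomial σ k))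
    (hφ : ∀ b, F.hdeg b < n → F.D (φ (Finsupp.single b 1)) = φ (F.D (Finsupp.single b 1)) ∧
      F.ε (φ (Finsupp.single b 1)) - F.ε (Finsupp.single b 1) ∈ I) :
    ∃ s : (ι →₀ MvPolynomial σ k) →ₗ[MvPolynomial σ k] (ι →₀ MvPolynomial σ k),
      ∀ b, F.hdeg b < n → φ (Finsupp.single b 1) - Finsupp.single b 1 =
        F.D (s (Finsupp.single b 1)) + s (F.D (Finsupp.single b 1)) ∧
        F.ε (s (Finsupp.single b 1)) = 0 := by
  classical
  induction n with
  | zero => exact ⟨0, fun b hb => absurd hb (Nat.not_lt_zero _)⟩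
  | succ n ih =>
  obtain ⟨s, hs⟩ := ih fun b hb => hφ b (by omega)
  -- The condition `ε y = 0` is carried along because it puts the augmentation of the next
  -- right-hand side into `I`.
  have key : ∀ b, F.hdeg b = n → ∃ y, F.D y = φ (Finsupp.single b 1) - Finsupp.single b 1 -
      s (F.D (Finsupp.single b 1)) ∧ F.ε y = 0 := by
    intro b hb
    have hsupp : ∀ c ∈ (F.D (Finsupp.single b 1)).support, F.hdeg c < n :=
      fun c hc => hb ▸ F.hdeg_lt_of_mem_support_D hc
    have h1 : (φ - (LinearMap.id : (ι →₀ MvPolynomial σ k) →ₗ[MvPolynomial σ k] _))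
        (F.D (Finsupp.single b 1)) =
        (F.D ∘ₗ s + s ∘ₗ F.D) (F.D (Finsupp.single b 1)) :=
      Finsupp.linearMap_congr_on_support fun c hc => (hs c (hsupp c hc)).1
    have h2 : (F.ε ∘ₗ s) (F.D (Finsupp.single b 1)) ∈ (⊥ : Ideal (MvPolynomial σ k)) :=
      Finsupp.linearMap_mem_of_support fun c hc => (hs c (hsupp c hc)).2
    obtain ⟨h3, h4⟩ := hφ b (by omega)
    simp only [LinearMap.sub_apply, LinearMap.id_apply, LinearMap.add_apply,
      LinearMap.comp_apply, F.isFreeResolution.D_D, map_zero, add_zero] at h1 h2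
    refine F.exact_ε _ ?_ ?_
    · rw [map_sub, map_sub, h3, ← h1, sub_self]
    · rw [map_sub, map_sub, (Submodule.mem_bot _).mp h2, sub_zero]
      exact h4
  choose! Y hY using key
  let s' : (ι →₀ MvPolynomial σ k) →ₗ[MvPolynomial σ k] (ι →₀ MvPolynomial σ k) :=
    Finsupp.linearCombination _ fun b => if F.hdeg b = n then Y b else s (Finsupp.single b 1)
  have hs' : ∀ b, s' (Finsupp.single b 1) =
      if F.hdeg b = n then Y b else s (Finsupp.single b 1) := by
    intro b
    simp [s']
  have hsD : ∀ b, F.hdeg b < n + 1 →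
      s' (F.D (Finsupp.single b 1)) = s (F.D (Finsupp.single b 1)) := by
    intro b hb
    refine Finsupp.linearMap_congr_on_support fun c hc => ?_
    have := F.hdeg_lt_of_mem_support_D hc
    rw [hs', if_neg (by omega)]
  refine ⟨s', fun b hb => ?_⟩
  rw [hsD b hb, hs']
  split_ifs with h
  · exact ⟨by rw [(hY b h).1]; abel, (hY b h).2⟩
  · exact hs b (by omega)

/-- Lift the identity to `f : F → G` and `g : G → F`. As `g ∘ f` is homotopic to the identity and
`D` has no constant terms, the matrices `P`, `Q` of constant terms in bidegree `(i, j)` satisfy `Q *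
P = 1`, and rank gives the bound. Bihomogeneity of `f` ensures that only basis vectors of the same
bidegree contribute. -/
theorem card_le_card (hI : ∀ p ∈ I, ∀ n, weightedHomogeneousComponent w n p ∈ I) (i : ℕ) (j : ℤ)
    {s : Finset ι} (hs : ∀ b, b ∈ s ↔ F.hdeg b = i ∧ F.deg b = j)
    {t : Finset κ} (ht : ∀ b, b ∈ t ↔ G.hdeg b = i ∧ G.deg b = j) : s.card ≤ t.card := by
  classical
  obtain ⟨f, hf⟩ := F.exists_chainMap G hI (i + 1)
  obtain ⟨g, hg⟩ := G.exists_chainMap F hI (i + 1)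
  have hfsupp : ∀ b, ∀ c ∈ (f (Finsupp.single b 1)).support, F.hdeg b < i + 1 →
      G.hdeg c < i + 1 := by
    intro b c hc hb
    by_contra h
    refine Finsupp.mem_support_iff.mp hc (((hf b hb).2.2 c).eq_zero_of_fst_ne_zero ?_)
    simp only [bideg, Prod.fst_sub]
    omega
  obtain ⟨σ', hσ⟩ := F.exists_homotopy (i + 1) (g ∘ₗ f) (by
    intro b hb
    simp only [LinearMap.comp_apply]
    constructor
    · rw [← (hf b hb).1]
      exact Finsupp.linearMap_congr_on_support (L := F.D ∘ₗ g) (L' := g ∘ₗ G.D)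
        fun c hc => (hg c (hfsupp b c hc hb)).1
    · have h1 : (F.ε ∘ₗ g - G.ε) (f (Finsupp.single b 1)) ∈ I :=
        Finsupp.linearMap_mem_of_support fun c hc => (hg c (hfsupp b c hc hb)).2.1
      have := I.add_mem h1 (hf b hb).2.1
      simpa using this)
  let P : Matrix t s k := Matrix.of fun c b => constantCoeff (f (Finsupp.single (b : ι) 1) (c : κ))
  let Q : Matrix s t k := Matrix.of fun b c => constantCoeff (g (Finsupp.single (c : κ) 1) (b : ι))
  have hQP : Q * P = 1 := by
    ext b' b
    have hb := (hs b).mp b.2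
    have hbi : F.hdeg b < i + 1 := by omega
    have h1 : constantCoeff (g (f (Finsupp.single (b : ι) 1)) (b' : ι)) =
        constantCoeff ((Finsupp.single (b : ι) 1 : ι →₀ MvPolynomial σ k) (b' : ι)) := by
      have := (hσ b hbi).1
      rw [LinearMap.comp_apply, sub_eq_iff_eq_add] at this
      rw [this, Finsupp.add_apply, Finsupp.add_apply, map_add, map_add, F.constantCoeff_D,
        Finsupp.linearMap_apply_eq_sum σ', Finsupp.sum_apply, Finsupp.sum, map_sum,
        Finset.sum_eq_zero, zero_add, zero_add]
      intro c _
      rw [Finsupp.smul_apply, smul_eq_mul, map_mul, F.D_minimal, zero_mul]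
    have h2 : constantCoeff (g (f (Finsupp.single (b : ι) 1)) (b' : ι)) =
        ∑ c ∈ t, constantCoeff (g (Finsupp.single c 1) (b' : ι)) *
          constantCoeff (f (Finsupp.single (b : ι) 1) c) := by
      rw [Finsupp.linearMap_apply_eq_sum g, Finsupp.sum_apply, Finsupp.sum, map_sum]
      refine Eq.trans (Finset.sum_congr rfl fun c _ => ?_)
        ((Finset.sum_subset (Finset.subset_union_left (s₂ := t)) fun c _ hc => ?_).trans
        (Finset.sum_subset (Finset.subset_union_right
          (s₁ := (f (Finsupp.single (b : ι) 1)).support)) fun c _ hc => ?_).symm)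
      · rw [Finsupp.smul_apply, smul_eq_mul, map_mul, mul_comm]
      · rw [Finsupp.notMem_support_iff.mp hc, map_zero, mul_zero]
      · rw [((hf b hbi).2.2 c).constantCoeff_eq_zero, mul_zero]
        rw [sub_ne_zero]
        intro h
        simp only [bideg, Prod.mk.injEq, Nat.cast_inj] at h
        exact hc ((ht c).mpr ⟨by omega, by omega⟩)
    rw [Matrix.mul_apply, Matrix.one_apply]
    simp only [P, Q, Matrix.of_apply]
    rw [Finset.sum_coe_sort t fun c => constantCoeff (g (Finsupp.single c 1) (b' : ι)) *
          constantCoeff (f (Finsupp.single (b : ι) 1) c), ← h2, h1, Finsupp.single_apply]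
    simp only [Subtype.ext_iff, eq_comm (a := (b : ι)), apply_ite constantCoeff, map_one, map_zero]
  have h1 := Matrix.rank_mul_le_right Q P
  rw [hQP, Matrix.rank_one, Fintype.card_coe] at h1
  exact h1.trans ((Matrix.rank_le_card_height P).trans_eq (Fintype.card_coe t))

/-- Graded Betti numbers do not depend on the minimal graded free resolution. -/
theorem card_eq_card (hI : ∀ p ∈ I, ∀ n, weightedHomogeneousComponent w n p ∈ I) (i : ℕ) (j : ℤ)
    {s : Finset ι} (hs : ∀ b, b ∈ s ↔ F.hdeg b = i ∧ F.deg b = j)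
    {t : Finset κ} (ht : ∀ b, b ∈ t ↔ G.hdeg b = i ∧ G.deg b = j) : s.card = t.card :=
  le_antisymm (F.card_le_card G hI i j hs ht) (G.card_le_card F hI i j ht hs)

end TotalResolution

/-! ### From a sequence of free modules to their direct sum. -/

namespace MinimalGradedFreeResolution

variable {k σ : Type*} [Field k] {w : σ → ℤ} {I : Ideal (MvPolynomial σ k)}
  (F : MinimalGradedFreeResolution w I)

/-- The basis of the direct sum of all free modules of the resolution. -/
abbrev TotalIndex : Type := Σ i : ℕ, Fin (F.rank i)

/-- The inclusion of the `i`-th free module into the direct sum. -/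
noncomputable def incl (i : ℕ) : (Fin (F.rank i) → MvPolynomial σ k) →ₗ[MvPolynomial σ k]
    (F.TotalIndex →₀ MvPolynomial σ k) :=
  Fintype.linearCombination _ fun b => Finsupp.single ⟨i, b⟩ 1

/-- The projection of the direct sum to the `i`-th free module. -/
noncomputable def level (i : ℕ) : (F.TotalIndex →₀ MvPolynomial σ k) →ₗ[MvPolynomial σ k]
    (Fin (F.rank i) → MvPolynomial σ k) :=
  LinearMap.pi fun b => Finsupp.lapply ⟨i, b⟩

theorem level_apply (i : ℕ) (x : F.TotalIndex →₀ MvPolynomial σ k) (b : Fin (F.rank i)) :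
    F.level i x b = x ⟨i, b⟩ := rfl

theorem incl_single (i : ℕ) (b : Fin (F.rank i)) :
    F.incl i (Pi.single b 1) = Finsupp.single ⟨i, b⟩ 1 := by
  rw [incl, Fintype.linearCombination_apply_single, one_smul]

theorem level_incl (i : ℕ) (v : Fin (F.rank i) → MvPolynomial σ k) :
    F.level i (F.incl i v) = v := by
  classical
  funext b
  simp [level_apply, incl, Fintype.linearCombination_apply, Finsupp.single_apply]

theorem level_incl_of_ne {i j : ℕ} (h : i ≠ j) (v : Fin (F.rank i) → MvPolynomial σ k) :
    F.level j (F.incl i v) = 0 := by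
  funext b
  simp [level_apply, incl, Fintype.linearCombination_apply, h]

theorem ext_level {x y : F.TotalIndex →₀ MvPolynomial σ k} (h : ∀ i, F.level i x = F.level i y) :
    x = y := by
  ext1 ⟨i, b⟩
  exact congrFun (h i) b

theorem eq_sum_incl_level (x : F.TotalIndex →₀ MvPolynomial σ k) :
    x = ∑ i ∈ x.support.image Sigma.fst, F.incl i (F.level i x) := by
  classical
  refine F.ext_level fun j => ?_
  rw [map_sum]
  by_cases hj : j ∈ x.support.image Sigma.fst
  · rw [Finset.sum_eq_single_of_mem j hj fun i _ hi => F.level_incl_of_ne hi _, level_incl]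
  · rw [Finset.sum_eq_zero fun i hi => F.level_incl_of_ne (fun h => hj (by rwa [← h])) _]
    funext b
    by_contra hb
    exact hj (Finset.mem_image.mpr ⟨⟨j, b⟩, Finsupp.mem_support_iff.mpr hb, rfl⟩)

/-- The image of a basis vector under the total differential. -/
noncomputable def totalDBasis : F.TotalIndex → (F.TotalIndex →₀ MvPolynomial σ k)
  | ⟨0, _⟩ => 0
  | ⟨i + 1, c⟩ => F.incl i (F.d i (Pi.single c 1))

/-- The total differential. -/
noncomputable def totalD : (F.TotalIndex →₀ MvPolynomial σ k) →ₗ[MvPolynomial σ k]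
    (F.TotalIndex →₀ MvPolynomial σ k) :=
  Finsupp.linearCombination _ F.totalDBasis

/-- The image of a basis vector under the lifted augmentation. -/
noncomputable def totalεBasis : F.TotalIndex → MvPolynomial σ k
  | ⟨0, b⟩ => (F.aug_homogeneous b).choose
  | ⟨_ + 1, _⟩ => 0

/-- The lifted augmentation on the direct sum. -/
noncomputable def totalε : (F.TotalIndex →₀ MvPolynomial σ k) →ₗ[MvPolynomial σ k]
    MvPolynomial σ k :=
  Finsupp.linearCombination _ F.totalεBasis

theorem totalD_single (b : F.TotalIndex) : F.totalD (Finsupp.single b 1) = F.totalDBasis b := by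
  simp [totalD]

theorem totalε_single (b : F.TotalIndex) : F.totalε (Finsupp.single b 1) = F.totalεBasis b := by
  simp [totalε]

theorem totalD_incl (i : ℕ) (v : Fin (F.rank (i + 1)) → MvPolynomial σ k) :
    F.totalD (F.incl (i + 1) v) = F.incl i (F.d i v) := by
  suffices h : F.totalD ∘ₗ F.incl (i + 1) = F.incl i ∘ₗ F.d i from LinearMap.congr_fun h v
  refine LinearMap.pi_ext' fun b => LinearMap.ext_ring ?_
  simp only [LinearMap.comp_apply, LinearMap.single_apply, incl_single, totalD_single, totalDBasis]

theorem level_totalD (i : ℕ) (x : F.TotalIndex →₀ MvPolynomial σ k) :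
    F.level i (F.totalD x) = F.d i (F.level (i + 1) x) := by
  suffices h : F.level i ∘ₗ F.totalD = F.d i ∘ₗ F.level (i + 1) from LinearMap.congr_fun h x
  refine Finsupp.lhom_ext' fun ⟨j, b⟩ => LinearMap.ext_ring ?_
  simp only [LinearMap.comp_apply, Finsupp.lsingle_apply, totalD_single]
  rw [← incl_single]
  cases j with
  | zero => rw [totalDBasis, level_incl_of_ne _ (by omega), map_zero, map_zero]
  | succ j =>
    rw [totalDBasis]
    by_cases h : j = i
    · subst h
      rw [level_incl, level_incl]
    · rw [level_incl_of_ne _ h, level_incl_of_ne _ (by omega), map_zero]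

/-- `totalε` uses chosen homogeneous representatives of the values of the augmentation, so it is
meaningful only modulo `I`. -/
theorem mk_totalε (x : F.TotalIndex →₀ MvPolynomial σ k) :
    Ideal.Quotient.mk I (F.totalε x) = F.aug (F.level 0 x) := by
  suffices h : (Ideal.Quotient.mkₐ (MvPolynomial σ k) I).toLinearMap ∘ₗ F.totalε =
      F.aug ∘ₗ F.level 0 from LinearMap.congr_fun h x
  refine Finsupp.lhom_ext' fun ⟨j, b⟩ => LinearMap.ext_ring ?_
  simp only [LinearMap.comp_apply, Finsupp.lsingle_apply, totalε_single]
  rw [← incl_single]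
  cases j with
  | zero =>
    rw [level_incl, totalεBasis]
    exact (F.aug_homogeneous b).choose_spec.2.symm
  | succ j => rw [level_incl_of_ne _ (by omega), totalεBasis, map_zero, map_zero]

/-- Exactness is checked one homological degree at a time; finite support lets the separate
preimages be added up. -/
theorem isFreeResolution_total : IsFreeResolution F.totalD F.totalε I where
  D_D x := by
    refine F.ext_level fun i => ?_
    rw [level_totalD, level_totalD, map_zero]
    exact (F.exact_d i).apply_apply_eq_zero _
  ε_D x := by
    rw [← Ideal.Quotient.eq_zero_iff_mem, mk_totalε, level_totalD]
    exact F.exact_aug.apply_apply_eq_zero _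
  ε_surjective := by
    obtain ⟨v, hv⟩ := F.aug_surjective (Ideal.Quotient.mk I 1)
    refine ⟨F.incl 0 v, ?_⟩
    rw [← Ideal.Quotient.mk_eq_mk_iff_sub_mem, mk_totalε, level_incl, hv]
  exact x hx hx' := by
    have key : ∀ i, ∃ y, F.d i y = F.level i x := by
      intro i
      cases i with
      | zero =>
        refine (F.exact_aug _).mp ?_
        rw [← mk_totalε]
        exact Ideal.Quotient.eq_zero_iff_mem.mpr hx'
      | succ i =>
        refine (F.exact_d i _).mp ?_
        rw [← level_totalD, hx, map_zero]
    choose y hy using key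
    refine ⟨∑ i ∈ x.support.image Sigma.fst, F.incl (i + 1) (y i), ?_⟩
    rw [map_sum]
    conv_rhs => rw [F.eq_sum_incl_level x]
    exact Finset.sum_congr rfl fun i _ => by rw [totalD_incl, hy]

/-- The total resolution of a minimal graded free resolution. -/
noncomputable def toTotalResolution : TotalResolution w I F.TotalIndex where
  D := F.totalD
  ε := F.totalε
  hdeg b := b.1
  deg b := F.deg b.1 b.2
  D_homogeneous := by
    rintro ⟨i, b⟩ ⟨j, c⟩
    rw [totalD_single, ← level_apply]
    cases i with
    | zero =>
      rw [totalDBasis, map_zero]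
      exact isWeightedHomogeneous_zero _ _ _
    | succ i =>
      rw [totalDBasis]
      by_cases h : i = j
      · subst h
        rw [level_incl]
        have e : ((((i + 1 : ℕ) : ℤ), F.deg (i + 1) b) - ((i : ℤ), F.deg i c) - (1, 0) : ℤ × ℤ) =
            (0, F.deg (i + 1) b - F.deg i c) := by
          refine Prod.ext ?_ ?_ <;> simp
        exact e ▸ isWeightedHomogeneous_bigradedWeight_iff.mpr (F.d_homogeneous i b c)
      · rw [level_incl_of_ne _ h]
        exact isWeightedHomogeneous_zero _ _ _
  ε_homogeneous := by
    rintro ⟨i, b⟩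
    rw [totalε_single]
    cases i with
    | zero =>
      rw [totalεBasis]
      exact isWeightedHomogeneous_bigradedWeight_iff.mpr (F.aug_homogeneous b).choose_spec.1
    | succ i => exact isWeightedHomogeneous_zero _ _ _
  D_minimal := by
    rintro ⟨i, b⟩ ⟨j, c⟩
    rw [totalD_single, ← level_apply]
    cases i with
    | zero => rw [totalDBasis, map_zero, Pi.zero_apply, map_zero]
    | succ i =>
      rw [totalDBasis]
      by_cases h : i = j
      · subst h
        rw [level_incl]
        exact mem_idealOfVars_smul_top_iff.mp (F.minimal i ⟨_, rfl⟩) c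
      · rw [level_incl_of_ne _ h, Pi.zero_apply, map_zero]
  isFreeResolution := F.isFreeResolution_total

end MinimalGradedFreeResolution

/-! ### Flat base change. -/

section BaseChange

open TensorProduct

variable {R S ι : Type*} [CommRing R] [CommRing S] (φ : R →+* S)

/-- Applying a ring homomorphism to the coordinates of a vector. -/
noncomputable def Finsupp.mapCoords : (ι →₀ R) →+ (ι →₀ S) :=
  Finsupp.mapRange.addMonoidHom φ.toAddMonoidHom

theorem Finsupp.mapCoords_apply (x : ι →₀ R) (b : ι) : Finsupp.mapCoords φ x b = φ (x b) := rfl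

theorem Finsupp.mapCoords_smul (r : R) (x : ι →₀ R) :
    Finsupp.mapCoords φ (r • x) = φ r • Finsupp.mapCoords φ x := by
  ext b
  simp [Finsupp.mapCoords_apply]

theorem Finsupp.mapCoords_single (b : ι) (r : R) :
    Finsupp.mapCoords φ (Finsupp.single b r) = Finsupp.single b (φ r) :=
  Finsupp.mapRange_single (hf := map_zero φ)

/-- The base change of an endomorphism of a free module. -/
noncomputable def baseChangeD (D : (ι →₀ R) →ₗ[R] (ι →₀ R)) : (ι →₀ S) →ₗ[S] (ι →₀ S) :=
  Finsupp.linearCombination S fun b => Finsupp.mapCoords φ (D (Finsupp.single b 1))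

/-- The base change of a linear form on a free module. -/
noncomputable def baseChangeε (ε : (ι →₀ R) →ₗ[R] R) : (ι →₀ S) →ₗ[S] S :=
  Finsupp.linearCombination S fun b => φ (ε (Finsupp.single b 1))

theorem baseChangeD_single (D : (ι →₀ R) →ₗ[R] (ι →₀ R)) (b : ι) :
    baseChangeD φ D (Finsupp.single b 1) = Finsupp.mapCoords φ (D (Finsupp.single b 1)) := by
  simp [baseChangeD]

theorem baseChangeε_single (ε : (ι →₀ R) →ₗ[R] R) (b : ι) :
    baseChangeε φ ε (Finsupp.single b 1) = φ (ε (Finsupp.single b 1)) := by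
  simp [baseChangeε]

theorem baseChangeD_mapCoords (D : (ι →₀ R) →ₗ[R] (ι →₀ R)) (x : ι →₀ R) :
    baseChangeD φ D (Finsupp.mapCoords φ x) = Finsupp.mapCoords φ (D x) := by
  induction x using Finsupp.induction_linear with
  | zero => simp
  | add x y hx hy => simp [hx, hy]
  | single b r =>
    rw [← Finsupp.smul_single_one b r, map_smul D, Finsupp.mapCoords_smul,
      Finsupp.mapCoords_smul, map_smul, Finsupp.mapCoords_single, map_one, baseChangeD_single]

theorem baseChangeε_mapCoords (ε : (ι →₀ R) →ₗ[R] R) (x : ι →₀ R) :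
    baseChangeε φ ε (Finsupp.mapCoords φ x) = φ (ε x) := by
  induction x using Finsupp.induction_linear with
  | zero => simp
  | add x y hx hy => simp [hx, hy]
  | single b r =>
    rw [← Finsupp.smul_single_one b r, map_smul ε, Finsupp.mapCoords_smul, smul_eq_mul, map_mul,
      map_smul, Finsupp.mapCoords_single, map_one, baseChangeε_single, smul_eq_mul]

theorem baseChangeD_comp {T : Type*} [CommRing T] (ψ : S →+* T)
    (D : (ι →₀ R) →ₗ[R] (ι →₀ R)) :
    baseChangeD ψ (baseChangeD φ D) = baseChangeD (ψ.comp φ) D := by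
  refine Finsupp.lhom_ext' fun b => LinearMap.ext_ring ?_
  simp only [LinearMap.comp_apply, Finsupp.lsingle_apply, baseChangeD_single]
  ext c
  simp [Finsupp.mapCoords_apply]

theorem baseChangeε_comp {T : Type*} [CommRing T] (ψ : S →+* T)
    (ε : (ι →₀ R) →ₗ[R] R) :
    baseChangeε ψ (baseChangeε φ ε) = baseChangeε (ψ.comp φ) ε := by
  refine Finsupp.lhom_ext' fun b => LinearMap.ext_ring ?_
  simp only [LinearMap.comp_apply, Finsupp.lsingle_apply, baseChangeε_single, RingHom.comp_apply]

/-- Flat base change preserves free resolutions. -/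
theorem IsFreeResolution.baseChange {D : (ι →₀ R) →ₗ[R] (ι →₀ R)} {ε : (ι →₀ R) →ₗ[R] R}
    {I : Ideal R} (h : IsFreeResolution D ε I) (hφ : φ.Flat) :
    IsFreeResolution (baseChangeD φ D) (baseChangeε φ ε) (I.map φ) where
  D_D x := by
    suffices h : baseChangeD φ D ∘ₗ baseChangeD φ D = 0 from LinearMap.congr_fun h x
    refine Finsupp.lhom_ext' fun b => LinearMap.ext_ring ?_
    simp only [LinearMap.comp_apply, Finsupp.lsingle_apply, baseChangeD_single,
      baseChangeD_mapCoords, h.D_D, map_zero, LinearMap.zero_apply]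
  ε_D x := by
    refine Finsupp.linearMap_mem_of_support (L := baseChangeε φ ε ∘ₗ baseChangeD φ D)
      fun b _ => ?_
    rw [LinearMap.comp_apply, baseChangeD_single, baseChangeε_mapCoords]
    exact Ideal.mem_map_of_mem φ (h.ε_D _)
  ε_surjective := by
    obtain ⟨x, hx⟩ := h.ε_surjective
    refine ⟨Finsupp.mapCoords φ x, ?_⟩
    rw [baseChangeε_mapCoords, ← map_one φ, ← map_sub]
    exact Ideal.mem_map_of_mem φ hx
  exact x hx hx' := by
    classical
    let := φ.toAlgebra
    have : Module.Flat R S := hφ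
    let π : (ι →₀ R) →ₗ[R] R ⧸ I := I.mkQ ∘ₗ ε
    -- Being a cycle with augmentation in `I` means lying in the kernel of the single map `D.prod
    -- π`, so flatness has only one exact pair to preserve.
    have hex : Function.Exact D (D.prod π) := by
      intro x
      rw [LinearMap.prod_apply, Function.prod_apply, Prod.mk_eq_zero]
      constructor
      · intro hx
        exact h.exact x hx.1 ((Submodule.Quotient.mk_eq_zero I).mp hx.2)
      · rintro ⟨y, rfl⟩
        exact ⟨h.D_D y, (Submodule.Quotient.mk_eq_zero I).mpr (h.ε_D y)⟩
    let Θ : S ⊗[R] (ι →₀ R) ≃ₗ[S] (ι →₀ S) := finsuppScalarRight R S S ι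
    have hΘ : ∀ (r : S) (y : ι →₀ R), Θ (r ⊗ₜ y) = r • Finsupp.mapCoords φ y := by
      intro r y
      ext b
      simp only [Θ, finsuppScalarRight_apply_tmul_apply, Finsupp.smul_apply,
        Finsupp.mapCoords_apply, smul_eq_mul, Algebra.smul_def, mul_comm r]
      rfl
    have hΘD : ∀ t, Θ (D.lTensor S t) = baseChangeD φ D (Θ t) := by
      intro t
      induction t with
      | zero => simp
      | add a b ha hb => rw [map_add, map_add, map_add, map_add, ha, hb]
      | tmul r y => rw [LinearMap.lTensor_tmul, hΘ, hΘ, map_smul, baseChangeD_mapCoords]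
    -- Of the isomorphism of `S ⧸ I S` with `S ⊗ R ⧸ I`, only the fact that `I S` dies in the tensor
    -- product is needed.
    let j : S →ₗ[S] S ⊗[R] (R ⧸ I) := LinearMap.toSpanSingleton S _ (1 ⊗ₜ[R] (I.mkQ 1))
    have hj : ∀ r, j r = r ⊗ₜ[R] (I.mkQ 1) := by
      intro r
      simp [j, smul_tmul']
    have hjI : I.map φ ≤ LinearMap.ker j := by
      refine Ideal.map_le_iff_le_comap.mpr fun a ha => ?_
      change j (φ a) = 0
      rw [hj, show φ a = a • (1 : S) by rw [Algebra.smul_def, mul_one]; rfl, smul_tmul,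
        ← map_smul, smul_eq_mul, mul_one, Submodule.mkQ_apply,
        (Submodule.Quotient.mk_eq_zero I).mpr ha, tmul_zero]
    have hΘε : ∀ t, π.lTensor S t = j (baseChangeε φ ε (Θ t)) := by
      intro t
      induction t with
      | zero => simp
      | add a b ha hb => rw [map_add, map_add, map_add, map_add, ha, hb]
      | tmul r y =>
        rw [LinearMap.lTensor_tmul, hΘ, map_smul, baseChangeε_mapCoords, hj, smul_eq_mul, mul_comm,
          show φ (ε y) * r = ε y • r by rw [Algebra.smul_def]; rfl, smul_tmul, ← map_smul,
          smul_eq_mul, mul_one]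
        rfl
    have hprod : ∀ t, prodRight R R S (ι →₀ R) (R ⧸ I) ((D.prod π).lTensor S t) =
        (D.lTensor S t, π.lTensor S t) := by
      intro t
      induction t with
      | zero => simp only [map_zero]; rfl
      | add a b ha hb => rw [map_add, map_add, map_add, map_add, ha, hb]; rfl
      | tmul r y => rfl
    obtain ⟨t, rfl⟩ := Θ.surjective x
    have h1 : D.lTensor S t = 0 := by
      apply Θ.injective
      rw [hΘD, hx, map_zero]
    have h2 : π.lTensor S t = 0 := by
      rw [hΘε]
      exact hjI hx'
    have h3 : (D.prod π).lTensor S t = 0 := by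
      apply (prodRight R R S (ι →₀ R) (R ⧸ I)).injective
      rw [hprod, h1, h2, map_zero]
      rfl
    obtain ⟨y, hy⟩ := (Module.Flat.lTensor_exact S hex t).mp h3
    exact ⟨Θ y, by rw [← hΘD, hy]⟩

end BaseChange

/-! ### Renaming variables and rescaling the grading. -/

section Rename

variable {k σ τ : Type*} [Field k] {w : σ → ℤ} {w' : τ → ℤ} {f : σ → τ} {m : ℤ}

/-- Renaming of variables as a ring homomorphism. -/
noncomputable abbrev renameHom (k : Type*) [Field k] (f : σ → τ) :
    MvPolynomial σ k →+* MvPolynomial τ k :=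
  ((rename f : MvPolynomial σ k →ₐ[k] MvPolynomial τ k) : MvPolynomial σ k →+* MvPolynomial τ k)

theorem isWeightedHomogeneous_bigradedWeight_rename (hw : ∀ v, w' (f v) = m * w v)
    {p : MvPolynomial σ k} {a n : ℤ} (hp : IsWeightedHomogeneous (bigradedWeight w) p (a, n)) :
    IsWeightedHomogeneous (bigradedWeight w') (rename f p) (a, m * n) := by
  intro d hd
  obtain ⟨u, rfl, hu⟩ := coeff_rename_ne_zero f p d hd
  have h := hp hu
  rw [weight_bigradedWeight, Prod.mk.injEq] at h
  rw [weight_bigradedWeight, Prod.mk.injEq]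
  refine ⟨h.1, ?_⟩
  rw [← h.2, Finsupp.weight_apply, Finsupp.weight_apply, Finsupp.sum_mapDomain_index (by simp)
    (by intros; rw [add_smul]), Finsupp.mul_sum]
  refine Finsupp.sum_congr fun v _ => ?_
  rw [hw, mul_smul_comm]

/-- Base change of a resolution along a flat renaming of variables that rescales the grading. -/
noncomputable def TotalResolution.rename {I : Ideal (MvPolynomial σ k)} {ι : Type*}
    (F : TotalResolution w I ι) (hw : ∀ v, w' (f v) = m * w v)
    (hf : (renameHom k f).Flat) : TotalResolution w' (I.map (renameHom k f)) ι where
  D := baseChangeD (renameHom k f) F.D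
  ε := baseChangeε (renameHom k f) F.ε
  hdeg := F.hdeg
  deg b := m * F.deg b
  D_homogeneous b c := by
    rw [baseChangeD_single, Finsupp.mapCoords_apply]
    have h := isWeightedHomogeneous_bigradedWeight_rename hw (F.D_homogeneous b c)
    have e : (((F.hdeg b : ℤ), m * F.deg b) - ((F.hdeg c : ℤ), m * F.deg c) - (1, 0) : ℤ × ℤ) =
        ((F.hdeg b : ℤ) - F.hdeg c - 1, m * (F.deg b - F.deg c - 0)) := by
      refine Prod.ext ?_ ?_
      · simp
      · simp [mul_sub]
    exact e ▸ h
  ε_homogeneous b := by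
    rw [baseChangeε_single]
    exact isWeightedHomogeneous_bigradedWeight_rename hw (F.ε_homogeneous b)
  D_minimal b c := by
    rw [baseChangeD_single, Finsupp.mapCoords_apply]
    exact (constantCoeff_rename f _).trans (F.D_minimal b c)
  isFreeResolution := F.isFreeResolution.baseChange _ hf

end Rename

/-! ### Tensor products of resolutions. -/

section Tensor

open TensorProduct

variable {R ι κ : Type*} [CommRing R]

/-- The differential of the tensor product of two complexes; `s` is the sign involution of the
first one. -/
noncomputable def tensorD (D s : (ι →₀ R) →ₗ[R] (ι →₀ R)) (D' : (κ →₀ R) →ₗ[R] (κ →₀ R)) :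
    (ι →₀ R) ⊗[R] (κ →₀ R) →ₗ[R] (ι →₀ R) ⊗[R] (κ →₀ R) :=
  TensorProduct.map D LinearMap.id + TensorProduct.map s D'

theorem tensorD_tmul (D s : (ι →₀ R) →ₗ[R] (ι →₀ R)) (D' : (κ →₀ R) →ₗ[R] (κ →₀ R))
    (x : ι →₀ R) (y : κ →₀ R) : tensorD D s D' (x ⊗ₜ y) = D x ⊗ₜ y + s x ⊗ₜ D' y := by
  rw [tensorD, LinearMap.add_apply, TensorProduct.map_tmul, TensorProduct.map_tmul,
    LinearMap.id_apply]

/-- The augmentation of the tensor product of two complexes. -/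
noncomputable def tensorε (ε : (ι →₀ R) →ₗ[R] R) (ε' : (κ →₀ R) →ₗ[R] R) :
    (ι →₀ R) ⊗[R] (κ →₀ R) →ₗ[R] R :=
  ε' ∘ₗ (TensorProduct.lid R _).toLinearMap ∘ₗ TensorProduct.map ε LinearMap.id

/-- The augmentation of the first factor of a tensor product of two complexes. -/
noncomputable def partialε (ε : (ι →₀ R) →ₗ[R] R) (κ : Type*) :
    (ι →₀ R) ⊗[R] (κ →₀ R) →ₗ[R] (κ →₀ R) :=
  (TensorProduct.lid R _).toLinearMap ∘ₗ TensorProduct.map ε LinearMap.id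

theorem partialε_tmul (ε : (ι →₀ R) →ₗ[R] R) (x : ι →₀ R) (y : κ →₀ R) :
    partialε ε κ (x ⊗ₜ y) = ε x • y := rfl

/-- The vectors all of whose coordinates lie in `K`. -/
abbrev coordsIn (K : Ideal R) (κ : Type*) : Submodule R (κ →₀ R) := Finsupp.submodule fun _ => K

theorem smul_mem_coordsIn {K : Ideal R} {r : R} (hr : r ∈ K) (y : κ →₀ R) :
    r • y ∈ coordsIn K κ := fun _ => K.mul_mem_right _ hr

theorem map_mem_coordsIn {K : Ideal R} (D' : (κ →₀ R) →ₗ[R] (κ →₀ R)) {y : κ →₀ R}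
    (hy : y ∈ coordsIn K κ) : D' y ∈ coordsIn K κ := by
  rw [Finsupp.linearMap_apply_eq_sum]
  exact Submodule.sum_mem _ fun b _ => smul_mem_coordsIn (hy b) _

section Components

variable (z : (ι →₀ R) ⊗[R] (κ →₀ R)) (c : κ)

open Classical in
/-- The tensor product with a free module as finitely supported functions. -/
noncomputable def coordEquiv (R ι κ : Type*) [CommRing R] :
    (ι →₀ R) ⊗[R] (κ →₀ R) ≃ₗ[R] (κ →₀ (ι →₀ R)) :=
  finsuppScalarRight R R (ι →₀ R) κ

theorem coordEquiv_tmul (x : ι →₀ R) (y : κ →₀ R) : coordEquiv R ι κ (x ⊗ₜ y) c = y c • x := by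
  classical
  exact finsuppScalarRight_apply_tmul_apply ..

theorem coordEquiv_symm_single (x : ι →₀ R) :
    (coordEquiv R ι κ).symm (Finsupp.single c x) = x ⊗ₜ Finsupp.single c 1 := by
  classical
  exact finsuppScalarRight_symm_apply_single ..

theorem coordEquiv_map_id (D : (ι →₀ R) →ₗ[R] (ι →₀ R)) :
    coordEquiv R ι κ (TensorProduct.map D LinearMap.id z) c = D (coordEquiv R ι κ z c) := by
  induction z with
  | zero => simp
  | add a b ha hb => simp only [map_add, Finsupp.add_apply, ha, hb]
  | tmul x y => rw [TensorProduct.map_tmul, coordEquiv_tmul, coordEquiv_tmul, map_smul]; rfl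

theorem partialε_apply (ε : (ι →₀ R) →ₗ[R] R) :
    partialε ε κ z c = ε (coordEquiv R ι κ z c) := by
  induction z with
  | zero => simp
  | add a b ha hb => simp only [map_add, Finsupp.add_apply, ha, hb]
  | tmul x y =>
    rw [partialε_tmul, coordEquiv_tmul, map_smul, Finsupp.smul_apply, smul_eq_mul, smul_eq_mul,
      mul_comm]

theorem coordEquiv_map_eq_sum (s : (ι →₀ R) →ₗ[R] (ι →₀ R)) (D' : (κ →₀ R) →ₗ[R] (κ →₀ R)) :
    coordEquiv R ι κ (TensorProduct.map s D' z) c =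
      (coordEquiv R ι κ z).sum fun c' x => D' (Finsupp.single c' 1) c • s x := by
  obtain ⟨f, rfl⟩ := (coordEquiv R ι κ).symm.surjective z
  rw [LinearEquiv.apply_symm_apply]
  induction f using Finsupp.induction_linear with
  | zero => simp
  | add f g hf hg =>
    rw [map_add, map_add, map_add, Finsupp.add_apply, hf, hg, Finsupp.sum_add_index']
    · simp
    · simp
  | single c' x =>
    rw [coordEquiv_symm_single, TensorProduct.map_tmul, coordEquiv_tmul,
      Finsupp.sum_single_index (by simp)]

end Components

section Acyclic

variable {D s : (ι →₀ R) →ₗ[R] (ι →₀ R)} {ε : (ι →₀ R) →ₗ[R] R} {K : Ideal R}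
  {D' : (κ →₀ R) →ₗ[R] (κ →₀ R)} {ε' : (κ →₀ R) →ₗ[R] R} {J : Ideal R} {hdeg : κ → ℕ}

/-- Modulo `K` the term with `ε ∘ D` dies and `ε` does not see the sign, so augmenting the first
factor is a chain map modulo `K`. -/
theorem partialε_tensorD_sub (hεD : ∀ x, ε (D x) ∈ K) (hεs : ∀ x, ε (s x) = ε x)
    (z : (ι →₀ R) ⊗[R] (κ →₀ R)) :
    partialε ε κ (tensorD D s D' z) - D' (partialε ε κ z) ∈ coordsIn K κ := by
  induction z with
  | zero => simp
  | add a b ha hb =>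
    have := Submodule.add_mem _ ha hb
    simp only [map_add]
    rwa [add_sub_add_comm]
  | tmul x y =>
    rw [tensorD_tmul, map_add, partialε_tmul, partialε_tmul, partialε_tmul, hεs, map_smul,
      add_sub_cancel_right]
    exact smul_mem_coordsIn (hεD x) y

theorem tensorD_tensorD (hDD : ∀ x, D (D x) = 0) (hsD : ∀ x, s (D x) = -D (s x))
    (hDD' : ∀ x, D' (D' x) = 0) (z : (ι →₀ R) ⊗[R] (κ →₀ R)) :
    tensorD D s D' (tensorD D s D' z) = 0 := by
  induction z with
  | zero => simp
  | add a b ha hb => simp only [map_add, ha, hb, add_zero]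
  | tmul x y =>
    rw [tensorD_tmul, map_add, tensorD_tmul, tensorD_tmul, hDD, hDD', hsD, zero_tmul, tmul_zero,
      neg_tmul, zero_add, add_zero]
    exact neg_add_cancel (_ : (ι →₀ R) ⊗[R] (κ →₀ R))

/-- Cycles of the tensor product that vanish modulo `K` in `R ⧸ K ⊗ G` are boundaries. -/
theorem exists_tensorD_eq_of_partialε_mem (hDD : ∀ x, D (D x) = 0) (hεD : ∀ x, ε (D x) ∈ K)
    (hex : ∀ x, D x = 0 → ε x ∈ K → ∃ y, D y = x ∧ ε y = 0)
    (hsD : ∀ x, s (D x) = -D (s x)) (hεs : ∀ x, ε (s x) = ε x) (hDD' : ∀ x, D' (D' x) = 0)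
    (hdeg_D' : ∀ b c, D' (Finsupp.single b 1) c ≠ 0 → hdeg b = hdeg c + 1) (n : ℕ)
    (z : (ι →₀ R) ⊗[R] (κ →₀ R)) (hzn : ∀ c, n ≤ hdeg c → coordEquiv R ι κ z c = 0)
    (hz : tensorD D s D' z = 0) (hzε : partialε ε κ z ∈ coordsIn K κ) :
    ∃ y, tensorD D s D' y = z := by
  classical
  -- `n` bounds the homological degrees of the second factor occurring in `z`. Subtracting a
  -- boundary clears the top ones.
  induction n generalizing z with
  | zero =>
    refine ⟨0, ?_⟩
    rw [map_zero]
    apply (coordEquiv R ι κ).injective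
    ext1 c
    rw [hzn c (Nat.zero_le _), map_zero]
    rfl
  | succ n ih =>
    have hcomp : ∀ z c, coordEquiv R ι κ (tensorD D s D' z) c = D (coordEquiv R ι κ z c) +
        (coordEquiv R ι κ z).sum fun c' x => D' (Finsupp.single c' 1) c • s x := by
      intro z c
      rw [tensorD, LinearMap.add_apply, map_add, Finsupp.add_apply, coordEquiv_map_id,
        coordEquiv_map_eq_sum]
    -- In the top degree `n`, contributions through `D'` would come from degree `n + 1`, where `z`
    -- vanishes; so these coordinates are cycles of `D`.
    have key : ∀ c, hdeg c = n → ∃ y, D y = coordEquiv R ι κ z c ∧ ε y = 0 := by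
      intro c hc
      refine hex _ ?_ ?_
      · have h1 := hcomp z c
        rw [hz, map_zero, Finsupp.sum, Finset.sum_eq_zero, add_zero] at h1
        · exact h1.symm
        · intro c' hc'
          have : D' (Finsupp.single c' 1) c = 0 := by
            by_contra hne
            have := hdeg_D' _ _ hne
            exact Finsupp.mem_support_iff.mp hc' (hzn c' (by omega))
          rw [this, zero_smul]
      · rw [← partialε_apply]
        exact hzε c
    choose! Y hY using key
    -- The condition that the coordinate be nonzero only secures finite support.
    let f : κ →₀ (ι →₀ R) := Finsupp.onFinset (coordEquiv R ι κ z).support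
      (fun c => if hdeg c = n ∧ coordEquiv R ι κ z c ≠ 0 then Y c else 0) (fun c hc => by
        rw [Finsupp.mem_support_iff]
        intro h
        exact hc (if_neg fun h' => h'.2 h))
    have hf : ∀ c, f c = if hdeg c = n ∧ coordEquiv R ι κ z c ≠ 0 then Y c else 0 := fun _ => rfl
    let y := (coordEquiv R ι κ).symm f
    have hy : coordEquiv R ι κ y = f := LinearEquiv.apply_symm_apply _ _
    have hDf : ∀ c, hdeg c = n → D (f c) = coordEquiv R ι κ z c := by
      intro c hc
      rw [hf]
      split_ifs with h
      · exact (hY c hc).1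
      · rw [map_zero, not_not.mp fun h' => h ⟨hc, h'⟩]
    suffices h : ∃ y', tensorD D s D' y' = z - tensorD D s D' y by
      obtain ⟨y', hy'⟩ := h
      exact ⟨y' + y, by rw [map_add, hy', sub_add_cancel]⟩
    refine ih (z - tensorD D s D' y) ?_ ?_ ?_
    · intro c hc
      have hsum : (f.sum fun c' x => D' (Finsupp.single c' 1) c • s x) = 0 := by
        refine Finset.sum_eq_zero fun c' _ => ?_
        dsimp only
        by_cases hc' : hdeg c' = n
        · have : D' (Finsupp.single c' 1) c = 0 := by
            by_contra hne
            have := hdeg_D' _ _ hne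
            omega
          rw [this, zero_smul]
        · rw [hf, if_neg fun h => hc' h.1, map_zero, smul_zero]
      rw [map_sub, Finsupp.sub_apply, hcomp, hy, hsum, add_zero]
      rcases hc.eq_or_lt with h | h
      · rw [hDf c h.symm, sub_self]
      · rw [hf, if_neg (by omega), map_zero, hzn c (by omega), sub_zero]
    · rw [map_sub, hz, tensorD_tensorD hDD hsD hDD']
      exact sub_zero (0 : (ι →₀ R) ⊗[R] (κ →₀ R))
    · have h1 : partialε ε κ y = 0 := by
        ext1 c
        rw [partialε_apply, hy, hf]
        split_ifs with h
        · exact (hY c h.1).2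
        · exact map_zero _
      have h2 := partialε_tensorD_sub (D' := D') hεD hεs y
      rw [h1, map_zero, sub_zero] at h2
      rw [map_sub]
      exact Submodule.sub_mem _ hzε h2

/-- The tensor product of a free resolution of `R ⧸ K` with a complex that becomes a resolution of
`R ⧸ (K ⊔ J)` modulo `K` is a resolution of `R ⧸ (K ⊔ J)`. -/
theorem IsFreeResolution.tensor (hF : IsFreeResolution D ε K)
    (hex : ∀ x, D x = 0 → ε x ∈ K → ∃ y, D y = x ∧ ε y = 0)
    (hsD : ∀ x, s (D x) = -D (s x)) (hεs : ∀ x, ε (s x) = ε x)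
    (hG : IsFreeResolution D' ε' J)
    (hdeg_D' : ∀ b c, D' (Finsupp.single b 1) c ≠ 0 → hdeg b = hdeg c + 1)
    (hmod : ∀ x, D' x ∈ coordsIn K κ → ε' x ∈ K ⊔ J → ∃ y, x - D' y ∈ coordsIn K κ) :
    IsFreeResolution
      ((finsuppTensorFinsupp' R ι κ).toLinearMap ∘ₗ tensorD D s D' ∘ₗ
        (finsuppTensorFinsupp' R ι κ).symm.toLinearMap)
      (tensorε ε ε' ∘ₗ (finsuppTensorFinsupp' R ι κ).symm.toLinearMap) (K ⊔ J) where
  D_D x := by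
    simp only [LinearMap.comp_apply, LinearEquiv.coe_coe, LinearEquiv.symm_apply_apply,
      tensorD_tensorD hF.D_D hsD hG.D_D, map_zero]
  ε_D x := by
    simp only [LinearMap.comp_apply, LinearEquiv.coe_coe, LinearEquiv.symm_apply_apply]
    generalize (finsuppTensorFinsupp' R ι κ).symm x = z
    induction z with
    | zero => simp
    | add a b ha hb =>
      rw [map_add, map_add]
      exact Ideal.add_mem _ ha hb
    | tmul x y =>
      rw [tensorD_tmul, map_add]
      change ε' (ε (D x) • y) + ε' (ε (s x) • D' y) ∈ _
      rw [map_smul, map_smul]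
      exact Ideal.add_mem _ (Ideal.mem_sup_left (K.mul_mem_right _ (hF.ε_D x)))
        (Ideal.mem_sup_right (J.mul_mem_left _ (hG.ε_D y)))
  ε_surjective := by
    obtain ⟨x, hx⟩ := hF.ε_surjective
    obtain ⟨y, hy⟩ := hG.ε_surjective
    refine ⟨finsuppTensorFinsupp' R ι κ (x ⊗ₜ y), ?_⟩
    simp only [LinearMap.comp_apply, LinearEquiv.coe_coe, LinearEquiv.symm_apply_apply]
    change ε' (ε x • y) - 1 ∈ _
    rw [map_smul, smul_eq_mul,
      show ε x * ε' y - 1 = (ε x - 1) * ε' y + (ε' y - 1) by ring]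
    exact Ideal.add_mem _ (Ideal.mem_sup_left (K.mul_mem_right _ hx)) (Ideal.mem_sup_right hy)
  exact x hx hx' := by
    simp only [LinearMap.comp_apply, LinearEquiv.coe_coe] at hx hx'
    obtain ⟨z, rfl⟩ := (finsuppTensorFinsupp' R ι κ).surjective x
    rw [LinearEquiv.symm_apply_apply] at hx hx'
    replace hx : tensorD D s D' z = 0 := by
      simpa using hx
    suffices h : ∃ y, tensorD D s D' y = z by
      obtain ⟨y, rfl⟩ := h
      exact ⟨finsuppTensorFinsupp' R ι κ y, by simp⟩
    have h1 : D' (partialε ε κ z) ∈ coordsIn K κ := by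
      have := partialε_tensorD_sub (D' := D') hF.ε_D hεs z
      rwa [hx, map_zero, zero_sub, Submodule.neg_mem_iff] at this
    obtain ⟨u, hu⟩ := hmod _ h1 hx'
    -- `u` bounds the image of `z` modulo `K`, and `ε x₀` is `1` modulo `K`; subtracting the
    -- boundary of `x₀ ⊗ₜ u` reduces to the case where this image vanishes.
    obtain ⟨x₀, hx₀⟩ := hF.ε_surjective
    have h2 : partialε ε κ (z - tensorD D s D' (x₀ ⊗ₜ u)) ∈ coordsIn K κ := by
      have h3 := partialε_tensorD_sub (D' := D') hF.ε_D hεs (x₀ ⊗ₜ[R] u)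
      have h4 : D' (ε x₀ • u - u) ∈ coordsIn K κ := by
        refine map_mem_coordsIn D' ?_
        have := smul_mem_coordsIn hx₀ u
        rwa [sub_smul, one_smul] at this
      rw [partialε_tmul] at h3
      have h5 := Submodule.sub_mem _ (Submodule.sub_mem _ hu h3) h4
      rw [map_sub] at h5 ⊢
      convert h5 using 1
      abel
    obtain ⟨y, hy⟩ := exists_tensorD_eq_of_partialε_mem hF.D_D hF.ε_D hex hsD hεs hG.D_D hdeg_D'
      ((coordEquiv R ι κ (z - tensorD D s D' (x₀ ⊗ₜ u))).support.sup hdeg + 1) _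
      (fun c hc => by
        by_contra hne
        have := Finset.le_sup (f := hdeg) (Finsupp.mem_support_iff.mpr hne)
        omega)
      (by
        rw [map_sub, hx, tensorD_tensorD hF.D_D hsD hG.D_D]
        exact sub_zero (0 : (ι →₀ R) ⊗[R] (κ →₀ R))) h2
    exact ⟨y + x₀ ⊗ₜ u, by rw [map_add, hy, sub_add_cancel]⟩

end Acyclic

end Tensor

namespace TotalResolution

variable {k σ : Type*} [Field k] {w : σ → ℤ} {K J : Ideal (MvPolynomial σ k)} {ι κ : Type*}
  (F : TotalResolution w K ι) (G : TotalResolution w J κ)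

/-- The involution acting by `(-1) ^ i` in homological degree `i`. -/
noncomputable def sign : (ι →₀ MvPolynomial σ k) →ₗ[MvPolynomial σ k] (ι →₀ MvPolynomial σ k) :=
  Finsupp.linearCombination _ fun b => (-1) ^ F.hdeg b • Finsupp.single b 1

theorem sign_single (b : ι) :
    F.sign (Finsupp.single b 1) = (-1 : MvPolynomial σ k) ^ F.hdeg b • Finsupp.single b 1 := by
  simp [sign]

theorem sign_D (x : ι →₀ MvPolynomial σ k) : F.sign (F.D x) = -F.D (F.sign x) := by
  suffices h : F.sign ∘ₗ F.D = -(F.D ∘ₗ F.sign) from LinearMap.congr_fun h x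
  refine Finsupp.lhom_ext' fun b => LinearMap.ext_ring ?_
  simp only [LinearMap.comp_apply, LinearMap.neg_apply, Finsupp.lsingle_apply, sign_single,
    map_smul]
  have h := Finsupp.linearMap_congr_on_support (x := F.D (Finsupp.single b 1)) (L := F.sign)
    (L' := -(-1 : MvPolynomial σ k) ^ F.hdeg b • LinearMap.id) fun c hc => by
      rw [sign_single, F.hdeg_of_D_ne_zero (Finsupp.mem_support_iff.mp hc), pow_succ]
      simp
  rw [h]
  simp

theorem ε_sign (x : ι →₀ MvPolynomial σ k) : F.ε (F.sign x) = F.ε x := by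
  suffices h : F.ε ∘ₗ F.sign = F.ε from LinearMap.congr_fun h x
  refine Finsupp.lhom_ext' fun b => LinearMap.ext_ring ?_
  simp only [LinearMap.comp_apply, Finsupp.lsingle_apply, sign_single, map_smul]
  by_cases hb : F.hdeg b = 0
  · rw [hb, pow_zero, one_smul]
  · rw [F.ε_single_of_hdeg_ne_zero hb, smul_zero]

theorem tensorD_single_apply (b b' : ι) (c c' : κ) :
    ((finsuppTensorFinsupp' (MvPolynomial σ k) ι κ).toLinearMap ∘ₗ tensorD F.D F.sign G.D ∘ₗ
      (finsuppTensorFinsupp' (MvPolynomial σ k) ι κ).symm.toLinearMap)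
      (Finsupp.single (b, c) 1) (b', c') =
    F.D (Finsupp.single b 1) b' * (Finsupp.single c 1 : κ →₀ MvPolynomial σ k) c' +
      (-1) ^ F.hdeg b * (Finsupp.single b 1 : ι →₀ MvPolynomial σ k) b' *
        G.D (Finsupp.single c 1) c' := by
  simp only [LinearMap.comp_apply, LinearEquiv.coe_coe]
  rw [finsuppTensorFinsupp'_symm_single_eq_single_one_tmul, tensorD_tmul, map_add,
    Finsupp.add_apply, finsuppTensorFinsupp'_apply_apply, finsuppTensorFinsupp'_apply_apply,
    sign_single]
  rfl

/-- The tensor product of two minimal graded free resolutions, if it is a resolution. -/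
noncomputable def tensor
    (hmod : ∀ x, G.D x ∈ coordsIn K κ → G.ε x ∈ K ⊔ J → ∃ y, x - G.D y ∈ coordsIn K κ) :
    TotalResolution w (K ⊔ J) (ι × κ) where
  D := (finsuppTensorFinsupp' (MvPolynomial σ k) ι κ).toLinearMap ∘ₗ tensorD F.D F.sign G.D ∘ₗ
        (finsuppTensorFinsupp' (MvPolynomial σ k) ι κ).symm.toLinearMap
  ε := tensorε F.ε G.ε ∘ₗ (finsuppTensorFinsupp' (MvPolynomial σ k) ι κ).symm.toLinearMap
  hdeg b := F.hdeg b.1 + G.hdeg b.2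
  deg b := F.deg b.1 + G.deg b.2
  D_homogeneous := by
    classical
    rintro ⟨b, c⟩ ⟨b', c'⟩
    rw [tensorD_single_apply]
    refine IsWeightedHomogeneous.add ?_ ?_
    · rw [Finsupp.single_apply]
      split_ifs with h
      · subst h
        rw [mul_one]
        have e : ((((F.hdeg b + G.hdeg c : ℕ) : ℤ), F.deg b + G.deg c) -
            (((F.hdeg b' + G.hdeg c : ℕ) : ℤ), F.deg b' + G.deg c) - (1, 0) : ℤ × ℤ) =
            ((F.hdeg b : ℤ), F.deg b) - ((F.hdeg b' : ℤ), F.deg b') - (1, 0) := by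
          refine Prod.ext ?_ ?_ <;> simp
        exact e ▸ F.D_homogeneous b b'
      · rw [mul_zero]
        exact isWeightedHomogeneous_zero _ _ _
    · rw [Finsupp.single_apply]
      split_ifs with h
      · subst h
        rw [mul_one]
        have e : ((((F.hdeg b + G.hdeg c : ℕ) : ℤ), F.deg b + G.deg c) -
            (((F.hdeg b + G.hdeg c' : ℕ) : ℤ), F.deg b + G.deg c') - (1, 0) : ℤ × ℤ) =
            ((G.hdeg c : ℤ), G.deg c) - ((G.hdeg c' : ℤ), G.deg c') - (1, 0) := by
          refine Prod.ext ?_ ?_ <;> simp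
        have h1 := (G.D_homogeneous c c').C_mul ((-1) ^ F.hdeg b)
        rw [map_pow, map_neg, map_one] at h1
        exact e ▸ h1
      · rw [mul_zero, zero_mul]
        exact isWeightedHomogeneous_zero _ _ _
  ε_homogeneous := by
    rintro ⟨b, c⟩
    have h1 : (tensorε F.ε G.ε ∘ₗ (finsuppTensorFinsupp' (MvPolynomial σ k) ι κ).symm.toLinearMap)
        (Finsupp.single (b, c) 1) = F.ε (Finsupp.single b 1) * G.ε (Finsupp.single c 1) := by
      simp only [LinearMap.comp_apply, LinearEquiv.coe_coe]
      rw [finsuppTensorFinsupp'_symm_single_eq_single_one_tmul]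
      change G.ε (F.ε (Finsupp.single b 1) • Finsupp.single c 1) = _
      rw [map_smul, smul_eq_mul]
    rw [h1]
    have e : (((F.hdeg b + G.hdeg c : ℕ) : ℤ), F.deg b + G.deg c) =
        ((F.hdeg b : ℤ), F.deg b) + ((G.hdeg c : ℤ), G.deg c) := by
      refine Prod.ext ?_ ?_ <;> simp
    exact e ▸ (F.ε_homogeneous b).mul (G.ε_homogeneous c)
  D_minimal := by
    rintro ⟨b, c⟩ ⟨b', c'⟩
    rw [tensorD_single_apply, map_add, map_mul, map_mul, F.D_minimal, G.D_minimal, zero_mul,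
      mul_zero, add_zero]
  isFreeResolution := F.isFreeResolution.tensor F.exact_ε F.sign_D F.ε_sign G.isFreeResolution
    (fun _ _ => G.hdeg_of_D_ne_zero) hmod

end TotalResolution

/-! ### Flatness of adjoining variables, and exactness modulo the other group. -/

section Flat

variable {k σ τ : Type*} [Field k]

/-- Extension of coefficients is a base change of `k → L`, which is flat because `k` is a field. -/
theorem flat_map_algebraMap (L : Type*) [CommRing L] [Algebra k L] :
    (MvPolynomial.map (algebraMap k L) : MvPolynomial τ k →+* MvPolynomial τ L).Flat := by
  let := algebraMvPolynomial (R := k) (S := L) (σ := τ)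
  exact Module.Flat.isBaseChange k (MvPolynomial τ k) L (MvPolynomial τ L)
    (Algebra.IsPushout.out (R := k) (S := MvPolynomial τ k) (R' := L) (S' := MvPolynomial τ L))

/-- A polynomial ring in two groups of variables as an iterated polynomial ring. -/
noncomputable abbrev sumHom (k τ σ : Type*) [Field k] :
    MvPolynomial (τ ⊕ σ) k →+* MvPolynomial τ (MvPolynomial σ k) :=
  (sumAlgEquiv k τ σ).toRingEquiv.toRingHom

theorem flat_of_sumAlgEquiv_comp {R : Type*} [CommRing R] {f : R →+* MvPolynomial (τ ⊕ σ) k}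
    (h : ((sumHom k τ σ).comp f).Flat) : f.Flat :=
  (RingHom.Flat.comp_iff_of_bijective_left
    (g := sumHom k τ σ) (sumAlgEquiv k τ σ).bijective).mp h

theorem sumAlgEquiv_comp_renameHom_inr :
    (sumHom k τ σ).comp (renameHom k Sum.inr) =
      (C : MvPolynomial σ k →+* MvPolynomial τ (MvPolynomial σ k)) := by
  ext <;> simp

theorem flat_rename_inr : (renameHom k (Sum.inr : σ → τ ⊕ σ)).Flat := by
  refine flat_of_sumAlgEquiv_comp ?_
  rw [sumAlgEquiv_comp_renameHom_inr, ← algebraMap_eq, RingHom.flat_algebraMap_iff]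
  infer_instance

/-- In the iterated polynomial ring `inr` is the inclusion of constants, while `inl` extends the
coefficients from `k` to `k[σ]`. -/
theorem flat_rename_inl : (renameHom k (Sum.inl : τ → τ ⊕ σ)).Flat := by
  refine flat_of_sumAlgEquiv_comp ?_
  have : (sumHom k τ σ).comp (renameHom k Sum.inl) =
      MvPolynomial.map (algebraMap k (MvPolynomial σ k)) := by
    ext <;> simp
  rw [this]
  exact flat_map_algebraMap _

theorem flat_rename_equiv (e : σ ≃ τ) : (renameHom k e).Flat :=
  RingHom.Flat.of_bijective (renameEquiv k e).bijective

/-- The quotient of a polynomial ring in two groups of variables by an ideal that only involves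
the second group, as a polynomial ring in the first group. -/
noncomputable def quotientMap (τ : Type*) (I : Ideal (MvPolynomial σ k)) :
    MvPolynomial (τ ⊕ σ) k →+* MvPolynomial τ (MvPolynomial σ k ⧸ I) :=
  (MvPolynomial.map (Ideal.Quotient.mk I)).comp (sumHom k τ σ)

theorem quotientMap_surjective (I : Ideal (MvPolynomial σ k)) :
    Function.Surjective (quotientMap τ I) :=
  (MvPolynomial.map_surjective _ Ideal.Quotient.mk_surjective).comp (sumAlgEquiv k τ σ).surjective

theorem ker_quotientMap (I : Ideal (MvPolynomial σ k)) :
    RingHom.ker (quotientMap τ I) = I.map (renameHom k Sum.inr) := by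
  rw [quotientMap, ← RingHom.comap_ker, ker_map, Ideal.mk_ker, ← sumAlgEquiv_comp_renameHom_inr,
    ← Ideal.map_map]
  exact Ideal.comap_map_of_bijective _ (sumAlgEquiv k τ σ).bijective

theorem quotientMap_comp_rename_inl (I : Ideal (MvPolynomial σ k)) :
    (quotientMap τ I).comp (renameHom k Sum.inl) =
      MvPolynomial.map (algebraMap k (MvPolynomial σ k ⧸ I)) := by
  ext
  · simp [quotientMap]
    rfl
  · simp [quotientMap]

/-- A resolution in one group of variables stays exact modulo an ideal that only involves another
group of variables. -/
theorem TotalResolution.exact_rename_inl_mod {w : τ → ℤ} {w' : τ ⊕ σ → ℤ} {m : ℤ}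
    {J : Ideal (MvPolynomial τ k)} {κ : Type*} (G : TotalResolution w J κ)
    (hw : ∀ v, w' (Sum.inl v) = m * w v) (I : Ideal (MvPolynomial σ k))
    (x : κ →₀ MvPolynomial (τ ⊕ σ) k)
    (hx : (G.rename hw flat_rename_inl).D x ∈ coordsIn (I.map (renameHom k Sum.inr)) κ)
    (hx' : (G.rename hw flat_rename_inl).ε x ∈
      I.map (renameHom k Sum.inr) ⊔ J.map (renameHom k Sum.inl)) :
    ∃ y, x - (G.rename hw flat_rename_inl).D y ∈
      coordsIn (I.map (renameHom k Sum.inr)) κ := by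
  set φ : MvPolynomial τ k →+* MvPolynomial (τ ⊕ σ) k := renameHom k Sum.inl with hφ
  rw [← ker_quotientMap] at *
  change baseChangeD φ G.D x ∈ _ at hx
  change baseChangeε φ G.ε x ∈ _ at hx'
  change ∃ y, x - baseChangeD φ G.D y ∈ _
  -- The quotient by the extension of `I` is `(k[σ] ⧸ I)[τ]`. It is flat over `k[τ]` as a
  -- coefficient extension, so `G` still resolves after base change to it.
  have hflat : RingHom.Flat (R := MvPolynomial τ k)
      (S := MvPolynomial τ (MvPolynomial σ k ⧸ I)) ((quotientMap τ I).comp φ) := by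
    rw [hφ, quotientMap_comp_rename_inl]
    exact flat_map_algebraMap _
  have hres := G.isFreeResolution.baseChange _ hflat
  rw [← baseChangeD_comp, ← baseChangeε_comp, ← Ideal.map_map] at hres
  obtain ⟨y', hy'⟩ := hres.exact (Finsupp.mapCoords (quotientMap τ I) x) (by
    rw [baseChangeD_mapCoords]
    ext1 c
    exact hx c) (by
    rw [baseChangeε_mapCoords]
    have h := Ideal.mem_map_of_mem (quotientMap τ I) hx'
    rw [Ideal.map_sup] at h
    refine (sup_le ?_ le_rfl : _ ≤ (J.map φ).map (quotientMap τ I)) h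
    rw [Ideal.map_le_iff_le_comap]
    intro p hp
    rw [Ideal.mem_comap, (RingHom.mem_ker).mp hp]
    exact Ideal.zero_mem _)
  obtain ⟨y, rfl⟩ : ∃ y, Finsupp.mapCoords (quotientMap τ I) y = y' :=
    Finsupp.mapRange_surjective _ (map_zero _) (quotientMap_surjective I) y'
  refine ⟨y, fun c => ?_⟩
  rw [baseChangeD_mapCoords] at hy'
  have h := DFunLike.congr_fun hy' c
  rw [Finsupp.mapCoords_apply, Finsupp.mapCoords_apply] at h
  rw [RingHom.mem_ker, Finsupp.sub_apply, map_sub, h, sub_self]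

end Flat

/-! ### The hypersurface factor. -/

section Koszul

variable {k σ : Type*} [Field k] {w : σ → ℤ}

/-- The resolution of a hypersurface ring. -/
noncomputable def hypersurfaceResolution {ρ : MvPolynomial σ k} {n : ℤ}
    (hρ : IsWeightedHomogeneous w ρ n) (hρ0 : ρ ≠ 0) (hρc : constantCoeff ρ = 0) :
    TotalResolution w (Ideal.span {ρ}) Bool where
  D := ρ • (Finsupp.lsingle false ∘ₗ Finsupp.lapply true)
  ε := Finsupp.lapply false
  hdeg b := cond b 1 0
  deg b := cond b n 0
  D_homogeneous b c := by
    have hρ' := isWeightedHomogeneous_bigradedWeight_iff.mpr hρ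
    cases b <;> cases c <;>
      simp [isWeightedHomogeneous_zero, hρ']
  ε_homogeneous b := by
    cases b
    · have h := isWeightedHomogeneous_one k (bigradedWeight w)
      simp only [Finsupp.lapply_apply, Finsupp.single_eq_same]
      exact h
    · simp [isWeightedHomogeneous_zero]
  D_minimal b c := by
    cases b <;> cases c <;> simp [hρc]
  isFreeResolution :=
    { D_D := fun x => by simp
      ε_D := fun x => by
        simp only [LinearMap.smul_apply, LinearMap.comp_apply, Finsupp.lapply_apply,
          Finsupp.lsingle_apply, Finsupp.smul_apply, Finsupp.single_eq_same, smul_eq_mul]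
        exact Ideal.mul_mem_right _ _ (Ideal.mem_span_singleton_self ρ)
      ε_surjective := ⟨Finsupp.single false 1, by simp⟩
      exact := fun x hx hx' => by
        obtain ⟨r, hr⟩ := Ideal.mem_span_singleton.mp hx'
        have h1 := DFunLike.congr_fun hx false
        refine ⟨Finsupp.single true r, ?_⟩
        ext1 b
        cases b
        · simpa using hr.symm
        · simpa [hρ0, eq_comm] using h1 }

/-- `hK` says that `ρ` is a nonzerodivisor modulo `K`: it puts the coordinate of a cycle in
homological degree one into `K`, while the other coordinate is a multiple of `ρ` up to `K`. -/
theorem hypersurfaceResolution_exact_mod {ρ : MvPolynomial σ k} {n : ℤ}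
    (hρ : IsWeightedHomogeneous w ρ n) (hρ0 : ρ ≠ 0) (hρc : constantCoeff ρ = 0)
    {K : Ideal (MvPolynomial σ k)} (hK : ∀ p, ρ * p ∈ K → p ∈ K) (x : Bool →₀ MvPolynomial σ k)
    (hx : (hypersurfaceResolution hρ hρ0 hρc).D x ∈ coordsIn K Bool)
    (hx' : (hypersurfaceResolution hρ hρ0 hρc).ε x ∈ K ⊔ Ideal.span {ρ}) :
    ∃ y, x - (hypersurfaceResolution hρ hρ0 hρc).D y ∈ coordsIn K Bool := by
  have h1 := hK (x true) (by simpa [hypersurfaceResolution] using hx false)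
  obtain ⟨p, hp, q, hq, hpq⟩ := Submodule.mem_sup.mp hx'
  obtain ⟨r, rfl⟩ := Ideal.mem_span_singleton.mp hq
  replace hpq : p + ρ * r = x false := hpq
  refine ⟨Finsupp.single true r, fun b => ?_⟩
  cases b
  · simpa [hypersurfaceResolution, ← hpq] using hp
  · simpa [hypersurfaceResolution] using h1

end Koszul

/-! ### Ideals of monomial curves. -/

section MonomialCurve

variable {k σ : Type*} [Field k]

theorem monomial_add_one (d d' : σ →₀ ℕ) :
    monomial (d + d') (1 : k) = monomial d 1 * monomial d' 1 := by
  rw [monomial_mul, one_mul]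

theorem monomial_nsmul_one (n : ℕ) (d : σ →₀ ℕ) :
    monomial (n • d) (1 : k) = monomial d 1 ^ n := by
  rw [monomial_pow, one_pow]

/-- The kernel of a map that sends monomials to a linearly independent family is contained in every
ideal that contains the differences of monomials with the same image. -/
theorem mem_of_monomial_sub_monomial_mem {M R : Type*} [CommRing R] [Algebra k R]
    {Φ : MvPolynomial σ k →ₐ[k] R} {e : M → R} (he : LinearIndependent k e)
    {g : (σ →₀ ℕ) → M} (hΦ : ∀ d, Φ (monomial d 1) = e (g d)) {J : Ideal (MvPolynomial σ k)}
    (hJ : ∀ d d', g d = g d' → monomial d (1 : k) - monomial d' 1 ∈ J)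
    {p : MvPolynomial σ k} (hp : Φ p = 0) : p ∈ J := by
  classical
  -- By `hJ` the class of a monomial modulo `J` depends only on its index in `M`, so the class of
  -- `p` is computed from the grouped coefficients `l`, which vanish by independence. The value `0`
  -- at indices not hit plays no role.
  let F : M → MvPolynomial σ k ⧸ J := fun m =>
    if h : ∃ d, g d = m then Ideal.Quotient.mkₐ k J (monomial h.choose 1) else 0
  have hF : ∀ d, Ideal.Quotient.mkₐ k J (monomial d 1) = F (g d) := by
    intro d
    have h : ∃ d', g d' = g d := ⟨d, rfl⟩
    simp only [F, dif_pos h]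
    exact (Ideal.Quotient.eq).mpr (hJ d _ h.choose_spec.symm)
  let l : M →₀ k := ∑ d ∈ p.support, Finsupp.single (g d) (coeff d p)
  have hsum : p = ∑ d ∈ p.support, coeff d p • monomial d (1 : k) := by
    conv_lhs => rw [p.as_sum]
    exact Finset.sum_congr rfl fun d _ => by rw [smul_monomial, smul_eq_mul, mul_one]
  have hl : l = 0 := by
    refine (linearIndependent_iff.mp he) l ?_
    simp only [l, map_sum, Finsupp.linearCombination_single, ← hΦ]
    rw [← hp]
    conv_rhs => rw [hsum, map_sum]
    exact Finset.sum_congr rfl fun d _ => (map_smul Φ _ _).symm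
  have h1 : Ideal.Quotient.mkₐ k J p = Finsupp.linearCombination k F l := by
    simp only [l, map_sum, Finsupp.linearCombination_single, ← hF]
    conv_lhs => rw [hsum, map_sum]
    exact Finset.sum_congr rfl fun d _ => map_smul (Ideal.Quotient.mkₐ k J) _ _
  rw [hl, map_zero] at h1
  exact Ideal.Quotient.eq_zero_iff_mem.mp h1

/-- The parametrization of a monomial curve. -/
noncomputable def monomialCurveHom (k : Type*) [Field k] (a : σ → ℕ) :
    MvPolynomial σ k →ₐ[k] Polynomial k :=
  aeval fun v => (Polynomial.X : Polynomial k) ^ a v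

theorem monomialCurveHom_monomial (a : σ → ℕ) (d : σ →₀ ℕ) (r : k) :
    monomialCurveHom k a (monomial d r) = Polynomial.monomial (Finsupp.weight a d) r := by
  rw [monomialCurveHom, aeval_monomial, Finsupp.prod, ← Polynomial.C_mul_X_pow_eq_monomial,
    Finsupp.weight_apply, Finsupp.sum, ← Finset.prod_pow_eq_pow_sum]
  congr 1
  refine Finset.prod_congr rfl fun v _ => ?_
  rw [← pow_mul, smul_eq_mul, mul_comm]

theorem weight_natCast (a : σ → ℕ) (d : σ →₀ ℕ) :
    Finsupp.weight (fun v => (a v : ℤ)) d = (Finsupp.weight a d : ℕ) := by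
  simp [Finsupp.weight_apply, Finsupp.sum]

/-- The parametrization respects degrees; homogeneity of its kernel follows. -/
theorem coeff_monomialCurveHom_component (a : σ → ℕ) (n : ℤ) (p : MvPolynomial σ k) (m : ℕ) :
    (monomialCurveHom k a (weightedHomogeneousComponent (fun v => (a v : ℤ)) n p)).coeff m =
      if (m : ℤ) = n then (monomialCurveHom k a p).coeff m else 0 := by
  classical
  induction p using MvPolynomial.induction_on' with
  | monomial d r =>
    rw [weightedHomogeneousComponent_of_mem
      (isWeightedHomogeneous_monomial (fun v => (a v : ℤ)) d r rfl), weight_natCast]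
    by_cases hm : Finsupp.weight a d = m
    · subst hm
      by_cases hn : ((Finsupp.weight a d : ℕ) : ℤ) = n
      · rw [if_pos hn, if_pos hn.symm]
      · rw [if_neg hn, if_neg fun h => hn h.symm, map_zero, Polynomial.coeff_zero]
    · rw [apply_ite (monomialCurveHom k a), map_zero, monomialCurveHom_monomial]
      split_ifs <;> simp [Polynomial.coeff_monomial, hm]
  | add p q hp hq =>
    simp only [map_add, Polynomial.coeff_add, hp, hq]
    split_ifs <;> simp

theorem component_mem_ker_monomialCurveHom (a : σ → ℕ) (p : MvPolynomial σ k)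
    (hp : p ∈ RingHom.ker (monomialCurveHom k a)) (n : ℤ) :
    weightedHomogeneousComponent (fun v => (a v : ℤ)) n p ∈
      RingHom.ker (monomialCurveHom k a) := by
  rw [RingHom.mem_ker] at hp ⊢
  ext m
  rw [coeff_monomialCurveHom_component, hp]
  simp

theorem constantCoeff_of_mem_ker_monomialCurveHom {a : σ → ℕ} (ha : ∀ v, 0 < a v)
    {p : MvPolynomial σ k} (hp : p ∈ RingHom.ker (monomialCurveHom k a)) :
    constantCoeff p = 0 := by
  have h : Polynomial.constantCoeff.comp ((monomialCurveHom k a : MvPolynomial σ k →+* _)) =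
      constantCoeff := by
    ext
    · simp [monomialCurveHom]
    · simp [monomialCurveHom, Polynomial.coeff_X_pow, (ha _).ne]
  rw [← h]
  change Polynomial.constantCoeff (monomialCurveHom k a p) = 0
  rw [(RingHom.mem_ker).mp hp, map_zero]

theorem monomial_sub_monomial_mem_ker (a : σ → ℕ) {d d' : σ →₀ ℕ}
    (h : Finsupp.weight a d = Finsupp.weight a d') :
    monomial d (1 : k) - monomial d' 1 ∈ RingHom.ker (monomialCurveHom k a) := by
  rw [RingHom.mem_ker, map_sub, monomialCurveHom_monomial, monomialCurveHom_monomial, h, sub_self]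

end MonomialCurve

/-! ### The ideal of a glued curve. -/

section Gluing

variable {k σ τ : Type*} [Field k] (a : σ → ℕ) (b : τ → ℕ)

theorem exists_eq_mapDomain_add (d : τ ⊕ σ →₀ ℕ) : ∃ (d₁ : σ →₀ ℕ) (d₂ : τ →₀ ℕ),
    d = d₂.mapDomain Sum.inl + d₁.mapDomain Sum.inr := by
  refine ⟨d.comapDomain Sum.inr Sum.inr_injective.injOn,
    d.comapDomain Sum.inl Sum.inl_injective.injOn, ?_⟩
  ext (v | v)
  · rw [Finsupp.add_apply, Finsupp.mapDomain_apply Sum.inl_injective,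
      Finsupp.mapDomain_of_notMem_range _ _ (by simp)]
    simp
  · rw [Finsupp.add_apply, Finsupp.mapDomain_apply Sum.inr_injective,
      Finsupp.mapDomain_of_notMem_range _ _ (by simp)]
    simp

theorem weight_mapDomain {M ι ι' : Type*} [AddCommMonoid M] (g : ι' → M) (f : ι → ι')
    (d : ι →₀ ℕ) : Finsupp.weight g (d.mapDomain f) = Finsupp.weight (g ∘ f) d := by
  rw [Finsupp.weight_apply, Finsupp.weight_apply, Finsupp.sum_mapDomain_index (by simp)
    (by intros; rw [add_smul])]
  rfl

/-- The sum of the ideals of two monomial curves in disjoint groups of variables. -/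
noncomputable def sumIdeal (k : Type*) [Field k] (a : σ → ℕ) (b : τ → ℕ) :
    Ideal (MvPolynomial (τ ⊕ σ) k) :=
  (RingHom.ker (monomialCurveHom k a)).map (renameHom k Sum.inr) ⊔
    (RingHom.ker (monomialCurveHom k b)).map (renameHom k Sum.inl)

variable {a b}

theorem mk_rename_inr_monomial {J : Ideal (MvPolynomial (τ ⊕ σ) k)} (hJ : sumIdeal k a b ≤ J)
    {d d' : σ →₀ ℕ} (h : Finsupp.weight a d = Finsupp.weight a d') :
    Ideal.Quotient.mk J (monomial (d.mapDomain Sum.inr) 1) =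
      Ideal.Quotient.mk J (monomial (d'.mapDomain Sum.inr) 1) := by
  rw [Ideal.Quotient.eq, ← rename_monomial, ← rename_monomial, ← map_sub]
  exact hJ (Ideal.mem_sup_left (Ideal.mem_map_of_mem (renameHom k Sum.inr)
    (monomial_sub_monomial_mem_ker a h)))

theorem mk_rename_inl_monomial {J : Ideal (MvPolynomial (τ ⊕ σ) k)} (hJ : sumIdeal k a b ≤ J)
    {d d' : τ →₀ ℕ} (h : Finsupp.weight b d = Finsupp.weight b d') :
    Ideal.Quotient.mk J (monomial (d.mapDomain Sum.inl) 1) =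
      Ideal.Quotient.mk J (monomial (d'.mapDomain Sum.inl) 1) := by
  rw [Ideal.Quotient.eq, ← rename_monomial, ← rename_monomial, ← map_sub]
  exact hJ (Ideal.mem_sup_right (Ideal.mem_map_of_mem (renameHom k Sum.inl)
    (monomial_sub_monomial_mem_ker b h)))

variable (a b) in
/-- The exponents of the images of the variables in the product of two monomial curves. -/
noncomputable def productExponent : τ ⊕ σ → (Bool →₀ ℕ) :=
  Sum.elim (fun v => Finsupp.single true (b v)) (fun v => Finsupp.single false (a v))

variable (k a b) in
/-- The parametrization of the product of two monomial curves. -/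
noncomputable def productHom : MvPolynomial (τ ⊕ σ) k →ₐ[k] MvPolynomial Bool k :=
  aeval fun v => monomial (productExponent a b v) 1

theorem productHom_monomial (d : τ ⊕ σ →₀ ℕ) :
    productHom k a b (monomial d 1) = monomial (Finsupp.weight (productExponent a b) d) 1 := by
  rw [productHom, aeval_monomial, map_one, one_mul, Finsupp.prod, Finsupp.weight_apply,
    Finsupp.sum, monomial_sum_one]
  exact Finset.prod_congr rfl fun v _ => by rw [monomial_pow, one_pow]

theorem weight_productExponent (d₁ : σ →₀ ℕ) (d₂ : τ →₀ ℕ) :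
    Finsupp.weight (productExponent a b) (d₂.mapDomain Sum.inl + d₁.mapDomain Sum.inr) =
      Finsupp.single true (Finsupp.weight b d₂) + Finsupp.single false (Finsupp.weight a d₁) := by
  rw [map_add, weight_mapDomain, weight_mapDomain]
  simp only [Finsupp.weight_apply, Finsupp.sum, Finsupp.single_finsetSum, productExponent,
    Function.comp_apply, Sum.elim_inl, Sum.elim_inr, Finsupp.smul_single]

/-- Monomials with the same image have equal weights in each group separately, so they can be
exchanged one group at a time. The point is that the target is a domain. -/
theorem ker_productHom : RingHom.ker (productHom k a b) = sumIdeal k a b := by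
  apply le_antisymm
  · intro p hp
    refine mem_of_monomial_sub_monomial_mem (basisMonomials Bool k).linearIndependent
      (fun d => productHom_monomial d) (fun d d' h => ?_) hp
    obtain ⟨d₁, d₂, rfl⟩ := exists_eq_mapDomain_add d
    obtain ⟨d₁', d₂', rfl⟩ := exists_eq_mapDomain_add d'
    rw [weight_productExponent, weight_productExponent] at h
    have h1 := DFunLike.congr_fun h false
    have h2 := DFunLike.congr_fun h true
    simp at h1 h2
    rw [← Ideal.Quotient.eq, monomial_add_one, monomial_add_one, map_mul, map_mul,
      mk_rename_inr_monomial le_rfl h1, mk_rename_inl_monomial le_rfl h2]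
  · refine sup_le ?_ ?_ <;> rw [Ideal.map_le_iff_le_comap] <;> intro p hp
    · have h : (productHom k a b).comp (rename Sum.inr) =
          (Polynomial.aeval (X false : MvPolynomial Bool k)).comp (monomialCurveHom k a) := by
        ext v
        simp [productHom, monomialCurveHom, productExponent, X_pow_eq_monomial]
      change (productHom k a b).comp (rename Sum.inr) p = 0
      rw [h, AlgHom.comp_apply, (RingHom.mem_ker).mp hp, map_zero]
    · have h : (productHom k a b).comp (rename Sum.inl) =
          (Polynomial.aeval (X true : MvPolynomial Bool k)).comp (monomialCurveHom k b) := by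
        ext v
        simp [productHom, monomialCurveHom, productExponent, X_pow_eq_monomial]
      change (productHom k a b).comp (rename Sum.inl) p = 0
      rw [h, AlgHom.comp_apply, (RingHom.mem_ker).mp hp, map_zero]

variable (k) in
/-- The binomial that glues two monomial curves. -/
noncomputable def gluingBinomial (u : σ →₀ ℕ) (v : τ →₀ ℕ) : MvPolynomial (τ ⊕ σ) k :=
  monomial (u.mapDomain Sum.inr) 1 - monomial (v.mapDomain Sum.inl) 1

variable {u : σ →₀ ℕ} {v : τ →₀ ℕ} {k₁ k₂ : ℕ}

/-- The two terms become powers of different variables, the first with positive exponent `k₂`. -/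
theorem productHom_gluingBinomial_ne_zero (hu : Finsupp.weight a u = k₂) (hk₂ : 0 < k₂) :
    productHom k a b (gluingBinomial k u v) ≠ 0 := by
  have h1 := weight_productExponent (a := a) (b := b) u 0
  have h2 := weight_productExponent (a := a) (b := b) 0 v
  simp only [Finsupp.mapDomain_zero, zero_add, add_zero, map_zero, Finsupp.single_zero] at h1 h2
  rw [gluingBinomial, map_sub, productHom_monomial, productHom_monomial, h1, h2, sub_ne_zero]
  intro h
  have h3 := (monomial_left_inj (one_ne_zero (α := k))).mp h
  have h4 := DFunLike.congr_fun h3 false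
  simp [hu] at h4
  omega

theorem mem_sumIdeal_of_gluingBinomial_mul_mem (hu : Finsupp.weight a u = k₂) (hk₂ : 0 < k₂)
    (p : MvPolynomial (τ ⊕ σ) k) (hp : gluingBinomial k u v * p ∈ sumIdeal k a b) :
    p ∈ sumIdeal k a b := by
  rw [← ker_productHom, RingHom.mem_ker] at hp ⊢
  rw [map_mul] at hp
  exact (mul_eq_zero.mp hp).resolve_left (productHom_gluingBinomial_ne_zero hu hk₂)

variable (a b k₁ k₂) in
/-- The weights of the variables of a glued curve. -/
def gluedWeight : τ ⊕ σ → ℕ := Sum.elim (fun v => k₂ * b v) (fun v => k₁ * a v)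

theorem weight_gluedWeight (d₁ : σ →₀ ℕ) (d₂ : τ →₀ ℕ) :
    Finsupp.weight (gluedWeight a b k₁ k₂) (d₂.mapDomain Sum.inl + d₁.mapDomain Sum.inr) =
      k₂ * Finsupp.weight b d₂ + k₁ * Finsupp.weight a d₁ := by
  rw [map_add, weight_mapDomain, weight_mapDomain]
  simp only [Finsupp.weight_apply, Finsupp.sum, gluedWeight, Function.comp_apply, Sum.elim_inl,
    Sum.elim_inr, smul_eq_mul, Finset.mul_sum, mul_left_comm]

/-- The glued curve is cut out of the product by one binomial. -/
theorem ker_monomialCurveHom_gluedWeight (hu : Finsupp.weight a u = k₂)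
    (hv : Finsupp.weight b v = k₁) (hk₂ : 0 < k₂) (hk : Nat.Coprime k₁ k₂) :
    RingHom.ker (monomialCurveHom k (gluedWeight a b k₁ k₂)) =
      sumIdeal k a b ⊔ Ideal.span {gluingBinomial k u v} := by
  set J := sumIdeal k a b ⊔ Ideal.span {gluingBinomial k u v} with hJ
  have hle : sumIdeal k a b ≤ J := le_sup_left
  have hρ : Ideal.Quotient.mk J (monomial (u.mapDomain Sum.inr) 1) =
      Ideal.Quotient.mk J (monomial (v.mapDomain Sum.inl) 1) := by
    rw [Ideal.Quotient.eq]
    exact Ideal.mem_sup_right (Ideal.mem_span_singleton_self _)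
  apply le_antisymm
  · intro p hp
    refine mem_of_monomial_sub_monomial_mem (Polynomial.basisMonomials k).linearIndependent
      (g := Finsupp.weight (gluedWeight a b k₁ k₂))
      (fun d => by rw [monomialCurveHom_monomial, Polynomial.coe_basisMonomials])
      (fun d d' h => ?_) hp
    rw [← Ideal.Quotient.eq]
    obtain ⟨d₁, d₂, rfl⟩ := exists_eq_mapDomain_add d
    obtain ⟨d₁', d₂', rfl⟩ := exists_eq_mapDomain_add d'
    rw [weight_gluedWeight, weight_gluedWeight] at h
    rw [monomial_add_one, monomial_add_one, map_mul, map_mul]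
    have key : ∀ d₁ d₁' : σ →₀ ℕ, ∀ d₂ d₂' : τ →₀ ℕ,
        k₂ * Finsupp.weight b d₂ + k₁ * Finsupp.weight a d₁ =
          k₂ * Finsupp.weight b d₂' + k₁ * Finsupp.weight a d₁' →
        Finsupp.weight a d₁ ≤ Finsupp.weight a d₁' →
        Ideal.Quotient.mk J (monomial (d₂.mapDomain Sum.inl) 1) *
            Ideal.Quotient.mk J (monomial (d₁.mapDomain Sum.inr) 1) =
          Ideal.Quotient.mk J (monomial (d₂'.mapDomain Sum.inl) 1) *
            Ideal.Quotient.mk J (monomial (d₁'.mapDomain Sum.inr) 1) := by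
      intro d₁ d₁' d₂ d₂' h hle'
      obtain ⟨m, hm⟩ := Nat.exists_eq_add_of_le hle'
      have h1 : k₂ * Finsupp.weight b d₂ = k₂ * Finsupp.weight b d₂' + k₁ * m := by
        rw [hm, mul_add] at h
        omega
      have h2 : k₂ ∣ k₁ * m := (Nat.dvd_add_right (Dvd.intro _ rfl)).mp (h1 ▸ Dvd.intro _ rfl)
      -- Coprimality makes the weight difference on the `A` side a multiple `k₂ * l`; it is balanced
      -- by trading `l` copies of `u` for `l` copies of `v`.
      obtain ⟨l, rfl⟩ := hk.symm.dvd_of_dvd_mul_left h2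
      have h3 : Finsupp.weight b d₂ = Finsupp.weight b d₂' + k₁ * l := by
        refine Nat.eq_of_mul_eq_mul_left hk₂ ?_
        rw [h1]
        ring
      have h4 : Finsupp.weight a d₁' = Finsupp.weight a (d₁ + l • u) := by
        rw [map_add, map_nsmul, hu, hm, smul_eq_mul, mul_comm l]
      have h5 : Finsupp.weight b d₂ = Finsupp.weight b (d₂' + l • v) := by
        rw [map_add, map_nsmul, hv, h3, smul_eq_mul, mul_comm l]
      rw [mk_rename_inr_monomial hle h4, mk_rename_inl_monomial hle h5, Finsupp.mapDomain_add,
        Finsupp.mapDomain_add, monomial_add_one, monomial_add_one, map_mul, map_mul,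
        Finsupp.mapDomain_smul, Finsupp.mapDomain_smul, monomial_nsmul_one, monomial_nsmul_one,
        map_pow, map_pow, hρ]
      ring
    rcases le_total (Finsupp.weight a d₁) (Finsupp.weight a d₁') with hle' | hle'
    · exact key _ _ _ _ h hle'
    · exact (key _ _ _ _ h.symm hle').symm
  · refine sup_le (sup_le ?_ ?_) ?_
    · rw [Ideal.map_le_iff_le_comap]
      intro p hp
      have h : (monomialCurveHom k (gluedWeight a b k₁ k₂)).comp (rename Sum.inr) =
          (Polynomial.expand k k₁).comp (monomialCurveHom k a) := by
        ext1 v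
        simp [monomialCurveHom, gluedWeight, pow_mul]
      change (monomialCurveHom k (gluedWeight a b k₁ k₂)).comp (rename Sum.inr) p = 0
      rw [h, AlgHom.comp_apply, (RingHom.mem_ker).mp hp, map_zero]
    · rw [Ideal.map_le_iff_le_comap]
      intro p hp
      have h : (monomialCurveHom k (gluedWeight a b k₁ k₂)).comp (rename Sum.inl) =
          (Polynomial.expand k k₂).comp (monomialCurveHom k b) := by
        ext1 v
        simp [monomialCurveHom, gluedWeight, pow_mul]
      change (monomialCurveHom k (gluedWeight a b k₁ k₂)).comp (rename Sum.inl) p = 0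
      rw [h, AlgHom.comp_apply, (RingHom.mem_ker).mp hp, map_zero]
    · rw [Ideal.span_singleton_le_iff_mem]
      have h1 := weight_gluedWeight (a := a) (b := b) (k₁ := k₁) (k₂ := k₂) u 0
      have h2 := weight_gluedWeight (a := a) (b := b) (k₁ := k₁) (k₂ := k₂) 0 v
      simp only [Finsupp.mapDomain_zero, zero_add, add_zero, map_zero, mul_zero] at h1 h2
      refine monomial_sub_monomial_mem_ker _ ?_
      rw [h1, h2, hu, hv, mul_comm]

end Gluing

/-! ### Application to numerical semigroups. -/

theorem exists_weight_eq_of_mem_closure {A : Finset ℕ} {n : ℕ}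
    (hn : n ∈ AddSubmonoid.closure (A : Set ℕ)) :
    ∃ u : A →₀ ℕ, Finsupp.weight (fun a : A => (a : ℕ)) u = n := by
  induction hn using AddSubmonoid.closure_induction with
  | mem x hx => exact ⟨Finsupp.single ⟨x, hx⟩ 1, by simp [Finsupp.weight_apply]⟩
  | zero => exact ⟨0, map_zero _⟩
  | add x y _ _ hx hy =>
    obtain ⟨u, rfl⟩ := hx
    obtain ⟨v, rfl⟩ := hy
    exact ⟨u + v, map_add _ _ _⟩

theorem IsNumericalMinGenSet.weight_pos {A : Finset ℕ} (hA : IsNumericalMinGenSet A) (a : A) :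
    0 < semigroupWeight A a := by
  have := hA.pos a a.2
  simp only [semigroupWeight]
  omega

/-- The semigroup ring of a numerical semigroup has a minimal graded free resolution. -/
theorem IsNumericalMinGenSet.nonempty_resolution {A : Finset ℕ} (hA : IsNumericalMinGenSet A)
    (k : Type*) [Field k] : Nonempty (SemigroupRingResolution k A) :=
  nonempty_minimalGradedFreeResolution hA.weight_pos
    (fun p hp n => component_mem_ker_monomialCurveHom _ p hp n)
    (fun _ hp => constantCoeff_of_mem_ker_monomialCurveHom
      (a := fun a : A => (a : ℕ)) (fun a => hA.pos a a.2) hp)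

namespace MinimalGradedFreeResolution

variable {k σ : Type*} [Field k] {w : σ → ℤ} {I : Ideal (MvPolynomial σ k)}
  (F : MinimalGradedFreeResolution w I)

/-- The basis vectors of homological degree `i` and internal degree `j`. -/
def bettiSet : ℤ → ℤ → Finset F.TotalIndex
  | Int.ofNat i, j =>
    (Finset.univ.filter fun b : Fin (F.rank i) => F.deg i b = j).map
      (Function.Embedding.sigmaMk (β := fun i => Fin (F.rank i)) i)
  | Int.negSucc _, _ => ∅

theorem card_bettiSet (i j : ℤ) : (F.bettiSet i j).card = F.betti i j := by
  cases i with
  | ofNat i => exact Finset.card_map _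
  | negSucc i => rfl

theorem mem_bettiSet {i j : ℤ} {b : F.TotalIndex} :
    b ∈ F.bettiSet i j ↔ (b.1 : ℤ) = i ∧ F.deg b.1 b.2 = j := by
  obtain ⟨m, b⟩ := b
  cases i with
  | ofNat i =>
    simp only [bettiSet, Finset.mem_map, Finset.mem_filter, Finset.mem_univ, true_and,
      Function.Embedding.sigmaMk_apply, Int.ofNat_eq_natCast, Nat.cast_inj]
    constructor
    · rintro ⟨c, hc, h⟩
      cases h
      exact ⟨rfl, hc⟩
    · rintro ⟨h, hb⟩
      subst h
      exact ⟨b, hb, rfl⟩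
  | negSucc i =>
    simp only [bettiSet, Finset.notMem_empty, false_iff, not_and]
    intro h
    omega

end MinimalGradedFreeResolution

namespace IsGluing

variable {C A B : Finset ℕ} {k₁ k₂ : ℕ}

/-- The generators of a glued semigroup, in terms of those of its two parts. -/
noncomputable def generatorEquiv (h : IsGluing C A B k₁ k₂) : B ⊕ A ≃ C :=
  Equiv.ofBijective
    (Sum.elim
      (fun b => ⟨k₂ * b, h.eq_union ▸ Finset.mem_union_right _
        (Finset.mem_image_of_mem (fun b => k₂ * b) b.2)⟩)
      (fun a => ⟨k₁ * a, h.eq_union ▸ Finset.mem_union_left _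
        (Finset.mem_image_of_mem (fun a => k₁ * a) a.2)⟩)) (by
    have hdisj : ∀ (a : A) (b : B), k₁ * (a : ℕ) ≠ k₂ * b := fun a b =>
      Finset.disjoint_left.mp h.disjoint |> fun hd e =>
        hd (Finset.mem_image_of_mem (fun a => k₁ * a) a.2)
          (e ▸ Finset.mem_image_of_mem (fun b => k₂ * b) b.2)
    constructor
    · rintro (b | a) (b' | a') e
      · have e := Nat.eq_of_mul_eq_mul_left h.pos₂ (Subtype.ext_iff.mp e)
        exact congrArg Sum.inl (Subtype.ext e)
      · exact absurd (Subtype.ext_iff.mp e).symm (hdisj a' b)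
      · exact absurd (Subtype.ext_iff.mp e) (hdisj a b')
      · have e := Nat.eq_of_mul_eq_mul_left h.pos₁ (Subtype.ext_iff.mp e)
        exact congrArg Sum.inr (Subtype.ext e)
    · rintro ⟨c, hc⟩
      have hc' := hc
      rw [h.eq_union, Finset.mem_union, Finset.mem_image, Finset.mem_image] at hc'
      rcases hc' with ⟨a, ha, rfl⟩ | ⟨b, hb, rfl⟩
      · exact ⟨Sum.inr ⟨a, ha⟩, rfl⟩
      · exact ⟨Sum.inl ⟨b, hb⟩, rfl⟩)

theorem coe_generatorEquiv (h : IsGluing C A B k₁ k₂) (v : B ⊕ A) :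
    (h.generatorEquiv v : ℕ) =
      gluedWeight (fun a : A => (a : ℕ)) (fun b : B => (b : ℕ)) k₁ k₂ v := by
  cases v <;> rfl

/-- For a bijective relabelling the extended ideal is a preimage along the inverse, and the preimage
of a kernel is the kernel of the composite. -/
theorem map_semigroupIdeal (h : IsGluing C A B k₁ k₂) (k : Type*) [Field k] :
    (semigroupIdeal k C).map (renameHom k h.generatorEquiv.symm) =
      RingHom.ker (monomialCurveHom k
        (gluedWeight (fun a : A => (a : ℕ)) (fun b : B => (b : ℕ)) k₁ k₂)) := by
  have h1 : (semigroupIdeal k C).map (renameHom k h.generatorEquiv.symm) =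
      (semigroupIdeal k C).comap (renameEquiv k h.generatorEquiv).toRingEquiv :=
    Ideal.map_symm (renameEquiv k h.generatorEquiv).toRingEquiv
  have h2 : (semigroupHom k C).comp (rename h.generatorEquiv) = monomialCurveHom k
      (gluedWeight (fun a : A => (a : ℕ)) (fun b : B => (b : ℕ)) k₁ k₂) := by
    ext1 v
    simp [semigroupHom, monomialCurveHom, coe_generatorEquiv]
  rw [h1, ← h2]
  rfl

end IsGluing

theorem TotalResolution.card_eq_card_of_eq {k σ ι κ : Type*} [Field k] {w : σ → ℤ}
    {I J : Ideal (MvPolynomial σ k)} (F : TotalResolution w I ι) (G : TotalResolution w J κ)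
    (hIJ : I = J) (hI : ∀ p ∈ I, ∀ n, weightedHomogeneousComponent w n p ∈ I) (i : ℕ) (j : ℤ)
    {s : Finset ι} (hs : ∀ b, b ∈ s ↔ F.hdeg b = i ∧ F.deg b = j)
    {t : Finset κ} (ht : ∀ b, b ∈ t ↔ G.hdeg b = i ∧ G.deg b = j) : s.card = t.card := by
  subst hIJ
  exact F.card_eq_card G hI i j hs ht

/-! ### The resolution of the gluing and the count of its basis. -/

section Betti

variable {k : Type*} [Field k] {C A B : Finset ℕ} {k₁ k₂ : ℕ}

/-- The resolution of a glued semigroup ring: the tensor product of the resolutions of the two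
parts and of the resolution of the hypersurface defined by the gluing binomial. -/
theorem IsGluing.exists_totalResolution (h : IsGluing C A B k₁ k₂)
    (FA : SemigroupRingResolution k A) (FB : SemigroupRingResolution k B) :
    ∃ T : TotalResolution (fun v => (gluedWeight (fun a : A => (a : ℕ)) (fun b : B => (b : ℕ))
        k₁ k₂ v : ℤ)) (RingHom.ker (monomialCurveHom k
        (gluedWeight (fun a : A => (a : ℕ)) (fun b : B => (b : ℕ)) k₁ k₂)))
        ((FA.TotalIndex × FB.TotalIndex) × Bool),
      (∀ x, T.hdeg x = x.1.1.1 + x.1.2.1 + cond x.2 1 0) ∧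
      (∀ x, T.deg x = k₁ * FA.deg _ x.1.1.2 + k₂ * FB.deg _ x.1.2.2 +
        cond x.2 ((k₁ : ℤ) * k₂) 0) := by
  obtain ⟨u, hu⟩ := exists_weight_eq_of_mem_closure h.mem₂
  obtain ⟨v, hv⟩ := exists_weight_eq_of_mem_closure h.mem₁
  set a : A → ℕ := fun a : A => (a : ℕ) with ha
  set b : B → ℕ := fun b : B => (b : ℕ) with hb
  set w : B ⊕ A → ℤ := fun v => (gluedWeight a b k₁ k₂ v : ℤ) with hw
  have hwA : ∀ x : A, w (Sum.inr x) = (k₁ : ℤ) * semigroupWeight A x := fun x => by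
    simp [hw, gluedWeight, semigroupWeight, ha]
  have hwB : ∀ x : B, w (Sum.inl x) = (k₂ : ℤ) * semigroupWeight B x := fun x => by
    simp [hw, gluedWeight, semigroupWeight, hb]
  have hρ : IsWeightedHomogeneous w (gluingBinomial k u v) ((k₁ : ℤ) * k₂) := by
    have h1 := weight_gluedWeight (a := a) (b := b) (k₁ := k₁) (k₂ := k₂) u 0
    have h2 := weight_gluedWeight (a := a) (b := b) (k₁ := k₁) (k₂ := k₂) 0 v
    simp only [Finsupp.mapDomain_zero, zero_add, add_zero, map_zero, mul_zero] at h1 h2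
    refine IsWeightedHomogeneous.sub (isWeightedHomogeneous_monomial _ _ _ ?_)
      (isWeightedHomogeneous_monomial _ _ _ ?_)
    · rw [hw, weight_natCast, h1, hu, Nat.cast_mul]
    · rw [hw, weight_natCast, h2, hv, Nat.cast_mul, mul_comm]
  have hρ0 : gluingBinomial k u v ≠ 0 := fun h0 =>
    productHom_gluingBinomial_ne_zero (k := k) (a := a) (b := b) (v := v) hu h.pos₂
      (by rw [h0, map_zero])
  have hρc : constantCoeff (gluingBinomial k u v) = 0 := by
    -- The degree `k₁ k₂` is positive; this makes the hypersurface factor minimal.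
    refine hρ.constantCoeff_eq_zero ?_
    have := h.pos₁
    have := h.pos₂
    positivity
  let RA := FA.toTotalResolution.rename hwA flat_rename_inr
  let RB := FB.toTotalResolution.rename hwB flat_rename_inl
  let T₁ := RA.tensor RB
    (FB.toTotalResolution.exact_rename_inl_mod hwB (semigroupIdeal k A))
  let T₂ := T₁.tensor (hypersurfaceResolution hρ hρ0 hρc)
    (hypersurfaceResolution_exact_mod hρ hρ0 hρc
      (mem_sumIdeal_of_gluingBinomial_mul_mem hu h.pos₂))
  rw [ker_monomialCurveHom_gluedWeight hu hv h.pos₂ h.coprime]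
  exact ⟨T₂, fun _ => rfl, fun _ => rfl⟩

/-- The basis vectors of bidegree `(i, j)` in the resolution of a glued semigroup ring. -/
noncomputable def gluedBettiSet (FA : SemigroupRingResolution k A)
    (FB : SemigroupRingResolution k B)
    (k₁ k₂ i : ℕ) (j : ℤ) : Finset ((FA.TotalIndex × FB.TotalIndex) × Bool) :=
  (Finset.range (i + 1) ×ˢ (Finset.Icc 0 j ×ˢ Finset.Icc 0 j).filter
    (fun p : ℤ × ℤ => (k₁ : ℤ) * p.1 + (k₂ : ℤ) * p.2 = j)).biUnion fun q =>
      (FA.bettiSet q.1 q.2.1 ×ˢ FB.bettiSet ((i : ℤ) - q.1) q.2.2) ×ˢ {false} ∪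
      (FA.bettiSet q.1 q.2.1 ×ˢ FB.bettiSet ((i : ℤ) - q.1 - 1) (q.2.2 - k₁)) ×ˢ {true}

/-- As degrees are nonnegative and `k₁, k₂ ≥ 1`, the equation `k₁ r + k₂ s = j` forces `r, s ≤ j`,
so the finite box of indices loses nothing. -/
theorem mem_gluedBettiSet (FA : SemigroupRingResolution k A) (FB : SemigroupRingResolution k B)
    (hA : ∀ x : FA.TotalIndex, 0 ≤ FA.deg _ x.2) (hB : ∀ x : FB.TotalIndex, 0 ≤ FB.deg _ x.2)
    (hk₁ : 0 < k₁) (hk₂ : 0 < k₂) (i : ℕ) (j : ℤ) (x : (FA.TotalIndex × FB.TotalIndex) × Bool) :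
    x ∈ gluedBettiSet FA FB k₁ k₂ i j ↔ x.1.1.1 + x.1.2.1 + cond x.2 1 0 = i ∧
      k₁ * FA.deg _ x.1.1.2 + k₂ * FB.deg _ x.1.2.2 + cond x.2 ((k₁ : ℤ) * k₂) 0 = j := by
  obtain ⟨⟨x, y⟩, e⟩ := x
  have hx := hA x
  have hy := hB y
  have hk₁' : (1 : ℤ) ≤ k₁ := by exact_mod_cast hk₁
  have hk₂' : (1 : ℤ) ≤ k₂ := by exact_mod_cast hk₂
  simp only [gluedBettiSet, Finset.mem_biUnion, Finset.mem_union, Finset.mem_product,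
    Finset.mem_singleton, MinimalGradedFreeResolution.mem_bettiSet, Finset.mem_filter,
    Finset.mem_range, Finset.mem_Icc, Prod.exists]
  constructor
  · rintro ⟨i', r, s, ⟨hi', -, hrs⟩, ⟨⟨⟨h1, h2⟩, h3, h4⟩, rfl⟩ | ⟨⟨⟨h1, h2⟩, h3, h4⟩, rfl⟩⟩
    · simp only [cond_false]
      refine ⟨by omega, ?_⟩
      rw [h2, h4, add_zero, hrs]
    · simp only [cond_true]
      refine ⟨by omega, ?_⟩
      rw [h2, h4, ← hrs]
      ring
  · rintro ⟨h1, h2⟩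
    cases e
    · simp only [cond_false, add_zero] at h1 h2
      refine ⟨x.1, FA.deg _ x.2, FB.deg _ y.2, ⟨by omega, ⟨⟨hx, ?_⟩, hy, ?_⟩, h2⟩,
        Or.inl ⟨⟨⟨rfl, rfl⟩, by omega, rfl⟩, rfl⟩⟩
      · nlinarith
      · nlinarith
    · simp only [cond_true] at h1 h2
      -- The extra degree `k₁ k₂` of the hypersurface generator is absorbed into `k₂ s` by raising
      -- `s` by `k₁`.
      refine ⟨x.1, FA.deg _ x.2, FB.deg _ y.2 + k₁, ⟨by omega, ⟨⟨hx, ?_⟩, by omega, ?_⟩, ?_⟩,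
        Or.inr ⟨⟨⟨rfl, rfl⟩, by omega, by omega⟩, rfl⟩⟩
      · nlinarith
      · nlinarith
      · rw [← h2]
        ring

/-- The pieces are disjoint because a pair of basis vectors and the Boolean determine `i'`, `r` and
`s`. -/
theorem card_gluedBettiSet (FA : SemigroupRingResolution k A) (FB : SemigroupRingResolution k B)
    (i : ℕ) (j : ℤ) : (gluedBettiSet FA FB k₁ k₂ i j).card =
      ∑ i' ∈ Finset.range (i + 1),
        ∑ p ∈ (Finset.Icc 0 j ×ˢ Finset.Icc 0 j).filter
            (fun p : ℤ × ℤ => (k₁ : ℤ) * p.1 + (k₂ : ℤ) * p.2 = j),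
          FA.betti i' p.1 *
            (FB.betti ((i : ℤ) - i') p.2 + FB.betti ((i : ℤ) - i' - 1) (p.2 - k₁)) := by
  rw [gluedBettiSet, Finset.card_biUnion, Finset.sum_product]
  · refine Finset.sum_congr rfl fun i' _ => Finset.sum_congr rfl fun p _ => ?_
    rw [Finset.card_union_of_disjoint]
    · simp only [Finset.card_product, Finset.card_singleton, mul_one,
        MinimalGradedFreeResolution.card_bettiSet, mul_add]
    · rw [Finset.disjoint_left]
      rintro ⟨z, e⟩ h1 h2
      have h1 := Finset.mem_singleton.mp (Finset.mem_product.mp h1).2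
      have h2 := Finset.mem_singleton.mp (Finset.mem_product.mp h2).2
      exact Bool.false_ne_true (h1.symm.trans h2)
  · rintro ⟨i', r, s⟩ - ⟨i'', r', s'⟩ - hne
    rw [Function.onFun, Finset.disjoint_left]
    rintro ⟨⟨x, y⟩, e⟩ h1 h2
    simp only [Finset.mem_union, Finset.mem_product, Finset.mem_singleton,
      MinimalGradedFreeResolution.mem_bettiSet] at h1 h2
    refine hne ?_
    rcases h1 with ⟨⟨⟨h1, h3⟩, h5, h7⟩, rfl⟩ | ⟨⟨⟨h1, h3⟩, h5, h7⟩, rfl⟩ <;>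
      rcases h2 with ⟨⟨⟨h2, h4⟩, h6, h8⟩, he⟩ | ⟨⟨⟨h2, h4⟩, h6, h8⟩, he⟩ <;>
      first
      | exact absurd he (by decide)
      | exact Prod.ext (by simp only; omega) (Prod.ext (by simp only; omega) (by simp only; omega))

end Betti

/-- Graded Betti numbers of a gluing `C = k₁ A ⊔ k₂ B`. Minimal graded free resolutions of the three
semigroup rings exist, and whichever of them are used to compute the graded Betti numbers, these
satisfy the formula. -/
theorem proposition3p9 {k : Type*} [Field k] (C A B : Finset ℕ) (k₁ k₂ : ℕ)
    (hC : IsGluing C A B k₁ k₂) :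
    Nonempty (SemigroupRingResolution k A) ∧
    Nonempty (SemigroupRingResolution k B) ∧
    Nonempty (SemigroupRingResolution k C) ∧
    ∀ (FA : SemigroupRingResolution k A) (FB : SemigroupRingResolution k B)
      (FC : SemigroupRingResolution k C) (i : ℕ) (j : ℤ),
      FC.betti i j =
        ∑ i' ∈ Finset.range (i + 1),
          ∑ p ∈ (Finset.Icc 0 j ×ˢ Finset.Icc 0 j).filter
              (fun p : ℤ × ℤ => (k₁ : ℤ) * p.1 + (k₂ : ℤ) * p.2 = j),
            FA.betti i' p.1 *
              (FB.betti ((i : ℤ) - i') p.2 + FB.betti ((i : ℤ) - i' - 1) (p.2 - k₁)) := by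
  refine ⟨hC.genA.nonempty_resolution k, hC.genB.nonempty_resolution k,
    hC.genC.nonempty_resolution k, fun FA FB FC i j => ?_⟩
  obtain ⟨T, hTh, hTd⟩ := hC.exists_totalResolution FA FB
  let w : B ⊕ A → ℤ := fun v =>
    (gluedWeight (fun a : A => (a : ℕ)) (fun b : B => (b : ℕ)) k₁ k₂ v : ℤ)
  have hw : ∀ c : C, w (hC.generatorEquiv.symm c) = 1 * semigroupWeight C c := by
    intro c
    simp only [w, ← hC.coe_generatorEquiv, Equiv.apply_symm_apply, one_mul, semigroupWeight]
  -- Relabelling, with scale factor `1`, moves the given resolution to the ring over which `T`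
  -- lives, where Betti numbers can be compared.
  let TC := FC.toTotalResolution.rename (w' := w) hw (flat_rename_equiv hC.generatorEquiv.symm)
  have hideal := hC.map_semigroupIdeal k
  rw [← card_gluedBettiSet FA FB i j, ← FC.card_bettiSet]
  refine TC.card_eq_card_of_eq T hideal ?_ i j ?_ ?_
  · rw [hideal]
    exact component_mem_ker_monomialCurveHom _
  · intro x
    rw [FC.mem_bettiSet, Nat.cast_inj]
    change _ ↔ x.1 = i ∧ 1 * FC.deg x.1 x.2 = j
    rw [one_mul]
  · intro x
    rw [hTh, hTd]
    exact mem_gluedBettiSet FA FB (FA.toTotalResolution.deg_nonneg hC.genA.weight_pos)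
      (FB.toTotalResolution.deg_nonneg hC.genB.weight_pos) hC.pos₁ hC.pos₂ i j x
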